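/- Let $\Theta=((0,\infty)\times(0,\infty))^{\mathbb Z}$ be the space of environments $\xi=(r_x^-,r_x^+)_{x\in\mathbb Z}$ and let $\mathbb P$ (with expectation $\mathbb E$) be a probability measure on $\Theta$ that is stationary and ergodic with respect to shifts. For $\lambda\in\mathbb R$, let $(Y_t^{\xi,\lambda})_{t\ge 0}$ be the continuous-time nearest-neighbour random walk on $\mathbb Z$ started at $0$ which jumps from $x$ to $x\pm1$ at rate $r_x^{\pm}e^{\pm\lambda}$. Put $\rho_x:=r_x^- /r_x^+$, let $v_Y(\lambda)$ denote the deterministic a.s. limit of $Y_t^{\xi,\lambda}/t$ as $t\to\infty$, and set $$\lambda_-:=\sup\{\lambda\in\mathbb R: v_Y(\lambda)<0\},\qquad \lambda_+:=\inf\{\lambda\in\mathbb R: v_Y(\lambda)>0\}$$ in $[-\infty,+\infty]$, with $\sup\emptyset=-\infty$ and $\inf\emptyset=+\infty$. **Proposition 4.5.** Assume that $\mathbb E[1/r_0^\pm]<\infty$ and $\mathbb E[\log r_0^\pm]<\infty$ (the latter expectations are well defined in $(-\infty,+\infty]$ because of the former condition). Then, for every $\lambda\in\mathbb R$, almost surely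 the walk does not explode, and the limit $v_Y(\lambda)$ exists and is deterministic. If moreover $\lambda_-=\lambda_+$, then $v_Y$ is continuous on $\mathbb R$, $\log\rho_0$ is integrable, $\lambda_-=\lambda_+=\tfrac12\,\mathbb E[\log\rho_0]$, and $v_Y(\lambda_\pm)=0$. -/

import Mathlib

open MeasureTheory ProbabilityTheory Filter Topology

noncomputable section

namespace RWRE

/-- The space `Θ = ((0, ∞) × (0, ∞))^ℤ` of environments `ξ = (r_x^-, r_x^+)_{x ∈ ℤ}`, with the
product σ-algebra. -/
abbrev Env : Type := ℤ → Set.Ioi (0 : ℝ) × Set.Ioi (0 : ℝ)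

/-- The unperturbed rate `r_x^-` of a jump from `x` to `x - 1`. -/
def rMinus (ξ : Env) (x : ℤ) : ℝ := (ξ x).1

/-- The unperturbed rate `r_x^+` of a jump from `x` to `x + 1`. -/
def rPlus (ξ : Env) (x : ℤ) : ℝ := (ξ x).2

/-- `ρ_x = r_x^- / r_x^+`. -/
def rho (ξ : Env) (x : ℤ) : ℝ := rMinus ξ x / rPlus ξ x

/-- The spatial shift `(θ ξ)_x = ξ_{x + 1}`. -/
def shift (ξ : Env) : Env := fun x => ξ (x + 1)

/-- The biased rate `r_x^-(l) = r_x^- e^{-l}`. -/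
def rMinusBiased (l : ℝ) (ξ : Env) (x : ℤ) : ℝ := rMinus ξ x * Real.exp (-l)

/-- The biased rate `r_x^+(l) = r_x^+ e^{l}`. -/
def rPlusBiased (l : ℝ) (ξ : Env) (x : ℤ) : ℝ := rPlus ξ x * Real.exp l

/-- The total biased rate `r_x^-(l) + r_x^+(l)` of a jump out of `x`. -/
def totalRate (l : ℝ) (ξ : Env) (x : ℤ) : ℝ := rMinusBiased l ξ x + rPlusBiased l ξ x

/-- The randomness that drives the walk: for every `n`, a pair `(γ_n, W_n)`. -/
abbrev Noise : Type := ℕ → unitInterval × ℝ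

/-- The law of the noise: all coordinates are independent, every `γ_n` is uniform on `[0, 1]` and
every `W_n` is exponential with mean `1`. -/
def noiseLaw : Measure Noise :=
  Measure.infinitePi fun _ : ℕ => (volume : Measure unitInterval).prod (expMeasure 1)

instance : IsProbabilityMeasure noiseLaw := by
  have : IsProbabilityMeasure (expMeasure 1) := isProbabilityMeasure_expMeasure one_pos
  unfold noiseLaw
  infer_instance

/-- The jump process in the biased environment: it starts at `0`, and from `x` it jumps to `x + 1`
with probability `r_x^+(l) / (r_x^-(l) + r_x^+(l))`, to `x - 1` otherwise. -/
def jumpChain (l : ℝ) (ξ : Env) (w : Noise) : ℕ → ℤ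
  | 0 => 0
  | n + 1 =>
    let x := jumpChain l ξ w n
    if ((w n).1 : ℝ) ≤ rPlusBiased l ξ x / totalRate l ξ x then x + 1 else x - 1

/-- The time `U_n` of the `n`-th jump (`U_0 = 0`). The time spent at a site `x` in one visit is
exponential with rate `r_x^-(l) + r_x^+(l)`. -/
def jumpTime (l : ℝ) (ξ : Env) (w : Noise) (n : ℕ) : ℝ :=
  ∑ k ∈ Finset.range n, (w k).2 / totalRate l ξ (jumpChain l ξ w k)

/-- The continuous time walk `Y_t` in the environment `ξ` with bias `l`: its position at time `t`
is that of the jump process after `n` jumps, where `U_n ≤ t < U_{n + 1}`. This is meaningful for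
all `t ≥ 0` as soon as the holding times are positive (a.s. the case) and `U_n → ∞`
(no explosion). -/
def walk (l : ℝ) (ξ : Env) (w : Noise) (t : ℝ) : ℤ :=
  jumpChain l ξ w (sInf {n : ℕ | t < jumpTime l ξ w (n + 1)})

/-- `v` is the asymptotic velocity at bias `l`: for almost every environment, almost surely the walk
does not explode and `Y_t / t → v` as `t → ∞`. -/
def IsAsymptoticVelocity (P : Measure Env) (l v : ℝ) : Prop :=
  ∀ᵐ ξ ∂P, ∀ᵐ w ∂noiseLaw,
    Tendsto (jumpTime l ξ w) atTop atTop ∧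
      Tendsto (fun t : ℝ => (walk l ξ w t : ℝ) / t) atTop (𝓝 v)

open Classical in
/-- The asymptotic velocity `v_Y(l)`, the almost sure limit of `Y_t / t` (set to `0` if
there is no such deterministic limit). -/
def velocity (P : Measure Env) (l : ℝ) : ℝ :=
  if h : ∃ v : ℝ, IsAsymptoticVelocity P l v then h.choose else 0

/-- `λ_- = sup {l ∈ ℝ | v_Y(l) < 0}` in `[-∞, ∞]`, with `sup ∅ = -∞`. -/
def lambdaMinus (P : Measure Env) : EReal :=
  sSup ((fun l : ℝ => (l : EReal)) '' {l : ℝ | velocity P l < 0})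

/-- `λ_+ = inf {l ∈ ℝ | v_Y(l) > 0}` in `[-∞, ∞]`, with `inf ∅ = +∞`. -/
def lambdaPlus (P : Measure Env) : EReal :=
  sInf ((fun l : ℝ => (l : EReal)) '' {l : ℝ | 0 < velocity P l})

end RWRE

end

/-! The moment assumptions make `log r_0^±` integrable, hence also `log ρ_0`; put `c = E[log ρ_0] /
2`. For `2l ≥ E[log ρ_0]` the quenched sums of products of `r^+ / r^-` read to the left diverge, so
the walk visits every positive site. Solving the first-step equations, the quenched mean time from
`0` to `1` is an explicit series (`crossingSeries`), and `meanCrossing P l` is its average over the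
environment, possibly infinite.

The passage from one first visit to the next is a map on pairs (environment, unused noise),
`ladder`. It preserves the product measure by the strong Markov property and is ergodic
(`ergodic_ladder`): an invariant set has trivial sections by a zero-one law, and ergodicity of the
shift does the rest. The time of the first visit of `n` is a Birkhoff sum of `ladderTime`, so by the
ergodic theorem the running maximum of the walk has speed `1 / meanCrossing P l`, with `1 / ∞ = 0`.
If `2l > E[log ρ_0]`, the walk is transient and remains close behind its maximum, so the walk has
the same speed (`isAsymptoticVelocity_of_forward`). The case `2l < E[log ρ_0]` follows by
reflection, and at equality the maximum and the minimum both have speed zero. This gives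
`isAsymptoticVelocity_formula`: the velocity is the difference of two reciprocals, one per
direction.

Averaging the series term by term shows that `meanCrossing P l` is `exp (-l)` times a power series
in `exp (-2l)` with nonnegative coefficients. Jensen's inequality bounds the coefficients below and
makes the series infinite for `l ≤ c` (`meanCrossing_eq_top`). Hence `λ_- ≤ c ≤ λ_+` always, and
equality of the outer terms pins both to `c`. It also makes the right crossing mean finite at every
`l > c` and its mirror image finite at every `l < c`. A series of this kind is continuous strictly
inside its region of finiteness, and at points where it is infinite by lower semicontinuity. The
only possible discontinuity, a jump from infinite to finite, is thus excluded. -/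

namespace RWRE

/-! ### Pointwise ergodic theorems and sums of exponentials of Birkhoff sums. -/

section ErgodicTheory

variable {α : Type*}

/-- The maximum of `0` and the first `N` Birkhoff sums of `f`, defined by recursion on `N`. -/
noncomputable def maxBirkhoff (T : α → α) (f : α → ℝ) : ℕ → α → ℝ
  | 0, _ => 0
  | N + 1, x => max 0 (f x + maxBirkhoff T f N (T x))

variable {T : α → α} {f : α → ℝ}

lemma maxBirkhoff_nonneg (N : ℕ) (x : α) : 0 ≤ maxBirkhoff T f N x := by
  cases N <;> simp [maxBirkhoff]

lemma maxBirkhoff_mono_succ (N : ℕ) (x : α) :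
    maxBirkhoff T f N x ≤ maxBirkhoff T f (N + 1) x := by
  induction N generalizing x with
  | zero => simp [maxBirkhoff]
  | succ N ih =>
    rw [maxBirkhoff, maxBirkhoff]
    gcongr
    exact ih _

lemma maxBirkhoff_mono (x : α) : Monotone fun N => maxBirkhoff T f N x :=
  monotone_nat_of_le_succ fun N => maxBirkhoff_mono_succ N x

lemma birkhoffSum_le_maxBirkhoff (N : ℕ) (x : α) : birkhoffSum T f N x ≤ maxBirkhoff T f N x := by
  induction N generalizing x with
  | zero => simp [maxBirkhoff]
  | succ N ih =>
    rw [maxBirkhoff, birkhoffSum_succ']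
    exact le_max_of_le_right (by gcongr; exact ih _)

lemma birkhoffSum_sub_const (c : ℝ) (n : ℕ) (x : α) :
    birkhoffSum T (fun y => f y - c) n x = birkhoffSum T f n x - n * c := by
  simp [birkhoffSum, Finset.sum_sub_distrib]

lemma birkhoffSum_mono {g : α → ℝ} (h : ∀ x, f x ≤ g x) (n : ℕ) (x : α) :
    birkhoffSum T f n x ≤ birkhoffSum T g n x :=
  Finset.sum_le_sum fun _ _ => h _

variable [MeasurableSpace α] {μ : Measure α}

lemma measurable_maxBirkhoff (hT : Measurable T) (hf : Measurable f) (N : ℕ) :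
    Measurable (maxBirkhoff T f N) := by
  induction N with
  | zero => exact measurable_const
  | succ N ih => exact measurable_const.max (hf.add (ih.comp hT))

lemma integrable_maxBirkhoff (hT : MeasurePreserving T μ μ) (hf : Integrable f μ) (N : ℕ) :
    Integrable (maxBirkhoff T f N) μ := by
  induction N with
  | zero => exact integrable_zero _ _ _
  | succ N ih =>
    have h : Integrable (fun x => f x + maxBirkhoff T f N (T x)) μ :=
      hf.add (hT.integrable_comp_of_integrable ih)
    exact (integrable_zero _ _ _).sup h

/-- By its recursion, boundedness of `maxBirkhoff` is an invariant event, so it is null or full. If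
it were null, the maxima along `T x` would tend to infinity and `maxBirkhoff (N + 1) - maxBirkhoff N
∘ T` would tend to `f`, dominated by `|f|`. Its integral is nonnegative by invariance and
monotonicity, which contradicts the negative mean. -/
lemma ae_bddAbove_birkhoffSum [IsProbabilityMeasure μ] (hT : Ergodic T μ) (hfm : Measurable f)
    (hf : Integrable f μ) (hneg : ∫ x, f x ∂μ < 0) :
    ∀ᵐ x ∂μ, BddAbove (Set.range fun n => birkhoffSum T f n x) := by
  have hTm := hT.measurable
  set A : Set α := {x | BddAbove (Set.range fun n => maxBirkhoff T f n x)} with hA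
  have hAm : MeasurableSet A := measurableSet_bddAbove_range fun n => measurable_maxBirkhoff hTm hfm n
  have hinv : T ⁻¹' A = A := by
    ext x
    simp only [hA, Set.mem_preimage, Set.mem_ofPred_eq]
    constructor
    · rintro ⟨B, hB⟩
      refine ⟨max 0 (f x + B), ?_⟩
      rintro _ ⟨n, rfl⟩
      refine (maxBirkhoff_mono_succ n x).trans ?_
      rw [maxBirkhoff]
      gcongr
      exact hB ⟨n, rfl⟩
    · rintro ⟨B, hB⟩
      refine ⟨B - f x, ?_⟩
      rintro _ ⟨n, rfl⟩
      have h1 : maxBirkhoff T f (n + 1) x ≤ B := hB ⟨n + 1, rfl⟩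
      have h2 : f x + maxBirkhoff T f n (T x) ≤ maxBirkhoff T f (n + 1) x := le_max_right _ _
      show maxBirkhoff T f n (T x) ≤ B - f x
      linarith
  rcases hT.toPreErgodic.ae_mem_or_ae_notMem hAm hinv with h | h
  · filter_upwards [h] with x hx
    obtain ⟨B, hB⟩ := hx
    refine ⟨B, ?_⟩
    rintro _ ⟨n, rfl⟩
    exact (birkhoffSum_le_maxBirkhoff n x).trans (hB ⟨n, rfl⟩)
  · exfalso
    have hlim : Tendsto (fun N => ∫ x, (maxBirkhoff T f (N + 1) x - maxBirkhoff T f N (T x)) ∂μ)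
        atTop (𝓝 (∫ x, f x ∂μ)) := by
      refine tendsto_integral_of_dominated_convergence (fun x => |f x|)
        (fun N => ((measurable_maxBirkhoff hTm hfm _).sub
          ((measurable_maxBirkhoff hTm hfm _).comp hTm)).aestronglyMeasurable) hf.abs ?_ ?_
      · intro N
        refine Eventually.of_forall fun x => ?_
        have h0 := maxBirkhoff_nonneg (T := T) (f := f) N (T x)
        rw [maxBirkhoff, Real.norm_eq_abs, abs_le]
        rcases max_cases 0 (f x + maxBirkhoff T f N (T x)) with ⟨h1, h2⟩ | ⟨h1, h2⟩ <;> rw [h1] <;>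
          constructor <;> cases abs_cases (f x) <;> linarith
      · filter_upwards [h] with x hx
        have hx' : T x ∉ A := fun h' => hx (by rw [← hinv]; exact h')
        have hev : ∀ᶠ N in atTop, -f x ≤ maxBirkhoff T f N (T x) := by
          simp only [hA, Set.mem_ofPred_eq, bddAbove_def, not_exists, not_forall] at hx'
          obtain ⟨_, ⟨n, rfl⟩, hn⟩ := hx' (-f x)
          filter_upwards [eventually_ge_atTop n] with N hN
          exact (not_le.1 hn).le.trans (maxBirkhoff_mono (T x) hN)
        refine tendsto_const_nhds.congr' ?_
        filter_upwards [hev] with N hN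
        rw [maxBirkhoff, max_eq_right (by linarith)]
        ring
    refine absurd (ge_of_tendsto' hlim fun N => ?_) (not_le.2 hneg)
    have hI := integrable_maxBirkhoff hT.toMeasurePreserving hf
    have hcomp : ∫ x, maxBirkhoff T f N (T x) ∂μ = ∫ x, maxBirkhoff T f N x ∂μ := by
      conv_rhs => rw [← hT.toMeasurePreserving.map_eq]
      rw [integral_map hTm.aemeasurable
        (measurable_maxBirkhoff hTm hfm N).aestronglyMeasurable]
    have hIT : Integrable (fun x => maxBirkhoff T f N (T x)) μ :=
      hT.toMeasurePreserving.integrable_comp_of_integrable (hI N)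
    rw [integral_sub (hI _) hIT, hcomp, sub_nonneg]
    exact integral_mono (hI _) (hI _) fun x => maxBirkhoff_mono_succ N x

lemma ae_eventually_birkhoffSum_div_lt [IsProbabilityMeasure μ] (hT : Ergodic T μ)
    (hfm : Measurable f) (hf : Integrable f μ) {c : ℝ} (hc : ∫ x, f x ∂μ < c) :
    ∀ᵐ x ∂μ, ∀ᶠ n : ℕ in atTop, birkhoffSum T f n x / n < c := by
  obtain ⟨d, hd1, hd2⟩ := exists_between hc
  have hI : Integrable (fun y => f y - d) μ := hf.sub (integrable_const d)
  have := ae_bddAbove_birkhoffSum hT (hfm.sub_const d) hI (by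
    rw [integral_sub hf (integrable_const d)]; simpa using hd1)
  filter_upwards [this] with x hx
  obtain ⟨B, hB⟩ := hx
  have h1 : Tendsto (fun n : ℕ => d + B / n) atTop (𝓝 (d + 0)) :=
    tendsto_const_nhds.add (tendsto_const_div_atTop_nhds_zero_nat B)
  rw [add_zero] at h1
  filter_upwards [h1.eventually_lt_const hd2, eventually_gt_atTop 0] with n hn hn0
  refine lt_of_le_of_lt ?_ hn
  have h2 : birkhoffSum T (fun y => f y - d) n x ≤ B := hB ⟨n, rfl⟩
  rw [birkhoffSum_sub_const] at h2
  have hn0' : (0 : ℝ) < n := by exact_mod_cast hn0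
  rw [div_le_iff₀ hn0', add_mul, div_mul_cancel₀ _ hn0'.ne']
  linarith

/-- Birkhoff's pointwise ergodic theorem for an ergodic transformation. -/
theorem ae_tendsto_birkhoffSum_div [IsProbabilityMeasure μ] (hT : Ergodic T μ)
    (hfm : Measurable f) (hf : Integrable f μ) :
    ∀ᵐ x ∂μ, Tendsto (fun n : ℕ => birkhoffSum T f n x / n) atTop (𝓝 (∫ x, f x ∂μ)) := by
  have hup : ∀ᵐ x ∂μ, ∀ k : ℕ, ∀ᶠ n : ℕ in atTop,
      birkhoffSum T f n x / n < ∫ x, f x ∂μ + 1 / (k + 1) :=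
    ae_all_iff.2 fun k => ae_eventually_birkhoffSum_div_lt hT hfm hf
      (lt_add_of_pos_right _ Nat.one_div_pos_of_nat)
  have hlo : ∀ᵐ x ∂μ, ∀ k : ℕ, ∀ᶠ n : ℕ in atTop,
      birkhoffSum T (fun y => - f y) n x / n < ∫ x, - f x ∂μ + 1 / (k + 1) :=
    ae_all_iff.2 fun k => ae_eventually_birkhoffSum_div_lt hT hfm.neg hf.neg
      (lt_add_of_pos_right _ Nat.one_div_pos_of_nat)
  filter_upwards [hup, hlo] with x h1 h2
  rw [Metric.tendsto_atTop']
  intro ε hε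
  obtain ⟨k, hk⟩ := exists_nat_one_div_lt hε
  obtain ⟨n, hn⟩ := eventually_atTop.1 ((h1 k).and (h2 k))
  refine ⟨n, fun m hm => ?_⟩
  obtain ⟨h3, h4⟩ := hn m hm.le
  have h5 : birkhoffSum T (fun y => - f y) m x = - birkhoffSum T f m x := by
    simp [birkhoffSum, Finset.sum_neg_distrib]
  rw [h5, integral_neg, neg_div] at h4
  rw [Real.dist_eq, abs_lt]
  constructor <;> linarith

/-- The ergodic theorem for a function that is almost everywhere nonnegative, with a
possibly infinite mean `m`: the number of summands over the sum converges to `1 / m`. -/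
theorem ae_tendsto_div_birkhoffSum [IsProbabilityMeasure μ] (hT : Ergodic T μ)
    (hfm : Measurable f) (hf : 0 ≤ᵐ[μ] f) (h0 : ∫⁻ x, ENNReal.ofReal (f x) ∂μ ≠ 0) :
    ∀ᵐ x ∂μ, Tendsto (fun n : ℕ => birkhoffSum T f n x) atTop atTop ∧
      Tendsto (fun n : ℕ => n / birkhoffSum T f n x) atTop
        (𝓝 ((∫⁻ x, ENNReal.ofReal (f x) ∂μ)⁻¹).toReal) := by
  by_cases htop : ∫⁻ x, ENNReal.ofReal (f x) ∂μ = ⊤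
  -- For an infinite mean, truncate at level `K`: the truncated means increase to infinity and bound
  -- the averages of `f` from below.
  · have hI : ∀ K : ℕ, Integrable (fun x => min (f x) K) μ := fun K => by
      refine Integrable.of_bound (hfm.min measurable_const).aestronglyMeasurable (K : ℝ) ?_
      filter_upwards [hf] with x hx
      rw [Real.norm_eq_abs, abs_of_nonneg (le_min hx (Nat.cast_nonneg K))]
      exact min_le_right _ _
    have hB := ae_all_iff.2 fun K : ℕ =>
      ae_tendsto_birkhoffSum_div hT (hfm.min measurable_const) (hI K)
    have hlim : Tendsto (fun K : ℕ => ∫ x, min (f x) K ∂μ) atTop atTop := by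
      have h1 : Tendsto (fun K : ℕ => ∫⁻ x, ENNReal.ofReal (min (f x) K) ∂μ) atTop (𝓝 ⊤) := by
        rw [← htop]
        refine lintegral_tendsto_of_tendsto_of_monotone
          (fun K => (hfm.min measurable_const).ennreal_ofReal.aemeasurable) ?_ ?_
        · refine Eventually.of_forall fun x K K' h => ?_
          refine ENNReal.ofReal_le_ofReal ?_
          gcongr
        · refine Eventually.of_forall fun x => tendsto_const_nhds.congr' ?_
          obtain ⟨K0, hK0⟩ := exists_nat_ge (f x)
          filter_upwards [eventually_ge_atTop K0] with K hK
          rw [min_eq_left (hK0.trans (by exact_mod_cast hK))]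
      have h2 : ∀ K : ℕ, ∫⁻ x, ENNReal.ofReal (min (f x) K) ∂μ
          = ENNReal.ofReal (∫ x, min (f x) K ∂μ) := fun K => by
        rw [ofReal_integral_eq_lintegral_ofReal (hI K)]
        filter_upwards [hf] with x hx using le_min hx (Nat.cast_nonneg K)
      simp_rw [h2] at h1
      exact ENNReal.tendsto_ofReal_nhds_top.1 h1
    filter_upwards [hB] with x hx
    have hdiv : Tendsto (fun n : ℕ => birkhoffSum T f n x / n) atTop atTop := by
      rw [tendsto_atTop]
      intro b
      obtain ⟨K, hK⟩ := (hlim.eventually_gt_atTop b).exists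
      filter_upwards [(hx K).eventually_const_lt hK] with n hn
      refine hn.le.trans ?_
      gcongr
      exact birkhoffSum_mono (fun y => min_le_left _ _) n x
    constructor
    · refine (hdiv.atTop_mul_atTop₀ tendsto_natCast_atTop_atTop).congr' ?_
      filter_upwards [eventually_gt_atTop 0] with n hn
      have : (n : ℝ) ≠ 0 := by positivity
      field_simp
    · rw [htop]
      simp only [ENNReal.inv_top, ENNReal.toReal_zero]
      refine hdiv.inv_tendsto_atTop.congr fun n => ?_
      simp
  · have hI : Integrable f μ := by
      rw [← lintegral_ofReal_ne_top_iff_integrable hfm.aestronglyMeasurable hf]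
      exact htop
    have hm : ∫⁻ x, ENNReal.ofReal (f x) ∂μ = ENNReal.ofReal (∫ x, f x ∂μ) :=
      (ofReal_integral_eq_lintegral_ofReal hI hf).symm
    have hpos : 0 < ∫ x, f x ∂μ := by
      by_contra h
      exact h0 (by rw [hm, ENNReal.ofReal_of_nonpos (not_lt.1 h)])
    filter_upwards [ae_tendsto_birkhoffSum_div hT hfm hI] with x hx
    constructor
    · refine (hx.pos_mul_atTop hpos tendsto_natCast_atTop_atTop).congr' ?_
      filter_upwards [eventually_gt_atTop 0] with n hn
      have : (n : ℝ) ≠ 0 := by positivity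
      field_simp
    · rw [hm, ENNReal.toReal_inv, ENNReal.toReal_ofReal hpos.le]
      refine (hx.inv₀ hpos.ne').congr fun n => ?_
      simp

/-- If `f` has negative mean, then the exponentials of its Birkhoff sums are summable. -/
theorem ae_summable_exp_birkhoffSum [IsProbabilityMeasure μ] (hT : Ergodic T μ)
    (hfm : Measurable f) (hf : Integrable f μ) (hneg : ∫ x, f x ∂μ < 0) :
    ∀ᵐ x ∂μ, Summable fun n => Real.exp (birkhoffSum T f n x) := by
  obtain ⟨c, hc1, hc2⟩ := exists_between hneg
  filter_upwards [ae_eventually_birkhoffSum_div_lt hT hfm hf hc1] with x hx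
  have hg : Summable fun n : ℕ => Real.exp (n * c) := Real.summable_exp_nat_mul_iff.2 hc2
  refine Summable.of_norm_bounded_eventually_nat hg ?_
  filter_upwards [hx, eventually_gt_atTop 0] with n hn hn0
  have hn0' : (0 : ℝ) < n := by exact_mod_cast hn0
  rw [Real.norm_eq_abs, Real.abs_exp, Real.exp_le_exp]
  rw [div_lt_iff₀ hn0'] at hn
  linarith

/-- If `f` has nonnegative mean, then the exponentials of its Birkhoff sums are not
summable. -/
theorem ae_not_summable_exp_birkhoffSum [IsProbabilityMeasure μ] (hT : Ergodic T μ)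
    (hfm : Measurable f) (hf : Integrable f μ) (hnn : 0 ≤ ∫ x, f x ∂μ) :
    ∀ᵐ x ∂μ, ¬ Summable fun n => Real.exp (birkhoffSum T f n x) := by
  have hTm := hT.measurable
  set e : ℕ → α → ℝ := fun n x => Real.exp (birkhoffSum T f n x) with he
  have hem : ∀ n, Measurable (e n) := fun n =>
    (Finset.measurable_fun_sum _ fun k _ => hfm.comp (hTm.iterate k)).exp
  have hsucc : ∀ n x, e (n + 1) x = Real.exp (f x) * e n (T x) := fun n x => by
    simp only [he]
    rw [birkhoffSum_succ', Real.exp_add]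
  have hshift : ∀ x, (Summable fun n => e n (T x)) ↔ Summable fun n => e n x := fun x => by
    rw [← summable_nat_add_iff 1 (f := fun n => e n x)]
    simp only [hsucc]
    rw [summable_mul_left_iff (Real.exp_ne_zero _)]
  set Z : α → ENNReal := fun x => ∑' n, ENNReal.ofReal (e n x) with hZ
  have hZm : Measurable Z := Measurable.tsum fun n => (hem n).ennreal_ofReal
  have hZtop : ∀ x, Z x ≠ ⊤ ↔ Summable fun n => e n x := fun x => by
    constructor
    · intro h
      have := ENNReal.summable_toReal h
      simpa [ENNReal.toReal_ofReal (Real.exp_pos _).le, he] using this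
    · exact fun h => h.tsum_ofReal_ne_top
  set A : Set α := {x | Z x ≠ ⊤} with hA
  have hAm : MeasurableSet A := (hZm (measurableSet_singleton ⊤)).compl
  have hinv : T ⁻¹' A = A := by
    ext x
    simp only [hA, Set.mem_preimage, Set.mem_ofPred_eq, hZtop, hshift]
  rcases hT.toPreErgodic.ae_mem_or_ae_notMem hAm hinv with h | h
  swap
  · filter_upwards [h] with x hx
    rwa [← hZtop]
  exfalso
  -- If `Z` were finite, `Z = 1 + exp f * Z ∘ T` would make `f` strictly smaller than the coboundary
  -- `φ - φ ∘ T`, which is impossible for a mean that is at least zero.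
  set φ : α → ℝ := fun x => Real.log (Z x).toReal with hφ
  have hφm : Measurable φ := hZm.ennreal_toReal.log
  have hrec : ∀ x, Z x = 1 + ENNReal.ofReal (Real.exp (f x)) * Z (T x) := fun x => by
    simp only [hZ]
    rw [tsum_eq_zero_add' ENNReal.summable, ← ENNReal.tsum_mul_left]
    congr 1
    · simp [he]
    · refine tsum_congr fun n => ?_
      rw [hsucc, ENNReal.ofReal_mul (Real.exp_pos _).le]
  have hZ1 : ∀ x, 1 ≤ Z x := fun x => by rw [hrec]; exact le_self_add
  set g : α → ℝ := fun x => φ x - φ (T x) - f x with hg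
  have hgm : Measurable g := (hφm.sub (hφm.comp hTm)).sub hfm
  have hgpos : ∀ x ∈ A, 0 < g x := by
    intro x hx
    have hx' : Z (T x) ≠ ⊤ := by
      have : x ∈ T ⁻¹' A := by rw [hinv]; exact hx
      exact this
    have h1 : (1 : ℝ) ≤ (Z (T x)).toReal := by
      rw [← ENNReal.toReal_one]
      exact ENNReal.toReal_mono hx' (hZ1 _)
    have h2 : (Z x).toReal = 1 + Real.exp (f x) * (Z (T x)).toReal := by
      rw [hrec, ENNReal.toReal_add (by simp) (ENNReal.mul_ne_top (by simp) hx'),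
        ENNReal.toReal_mul, ENNReal.toReal_ofReal (Real.exp_pos _).le, ENNReal.toReal_one]
    have h3 : Real.log (Real.exp (f x) * (Z (T x)).toReal) < φ x := by
      simp only [hφ]
      rw [h2]
      exact Real.log_lt_log (by positivity) (by linarith)
    rw [Real.log_mul (by positivity) (by positivity), Real.log_exp] at h3
    simp only [hg]
    simp only [hφ] at h3 ⊢
    linarith
  have hφnn : ∀ x, 0 ≤ φ x := fun x => by
    simp only [hφ]
    by_cases hx : Z x = ⊤
    · simp [hx]
    · refine Real.log_nonneg ?_
      rw [← ENNReal.toReal_one]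
      exact ENNReal.toReal_mono hx (hZ1 _)
  have hae : ∀ᵐ x ∂μ, 0 < g x := h.mono hgpos
  -- `φ` need not be integrable, so the positive gap `g` is truncated at `1`.
  have hgI : Integrable (fun x => min (g x) 1) μ := by
    refine Integrable.of_bound (hgm.min measurable_const).aestronglyMeasurable 1 ?_
    filter_upwards [hae] with x hx
    rw [Real.norm_eq_abs, abs_of_pos (lt_min hx one_pos)]
    exact min_le_right _ _
  have hgint : 0 < ∫ x, min (g x) 1 ∂μ := by
    rw [integral_pos_iff_support_of_nonneg_ae]
    · have : (Function.support fun x => min (g x) 1) =ᵐ[μ] Set.univ := by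
        filter_upwards [hae] with x hx
        exact eq_true (show min (g x) 1 ≠ 0 from (lt_min hx one_pos).ne')
      rw [measure_congr this]
      simp
    · filter_upwards [hae] with x hx using (lt_min hx one_pos).le
    · exact hgI
  obtain ⟨x, hx1, hx2⟩ := ((ae_tendsto_birkhoffSum_div hT (hgm.min measurable_const) hgI).and
    (ae_tendsto_birkhoffSum_div hT hfm hf)).exists
  have htel : ∀ n, birkhoffSum T g n x = φ x - φ (T^[n] x) - birkhoffSum T f n x := by
    intro n
    induction n with
    | zero => simp
    | succ n ih =>
      rw [birkhoffSum_succ, birkhoffSum_succ, ih, Function.iterate_succ_apply']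
      simp only [hg]
      ring
  -- Telescoping, then discarding `φ (T^[n] x) ≥ 0`: no control of `φ` along the orbit is needed.
  have hle : ∀ n : ℕ, birkhoffSum T (fun x => min (g x) 1) n x / n
      ≤ φ x / n - birkhoffSum T f n x / n := by
    intro n
    rw [← sub_div]
    gcongr
    refine (birkhoffSum_mono (fun y => min_le_left _ _) n x).trans ?_
    rw [htel]
    linarith [hφnn (T^[n] x)]
  have := le_of_tendsto_of_tendsto' hx1 ((tendsto_const_div_atTop_nhds_zero_nat (φ x)).sub hx2) hle
  linarith

end ErgodicTheory

end RWRE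

namespace RWRE

/-! ### The driving noise: past, future and independence. -/

section Noise

/-- The law of one coordinate of the noise. -/
noncomputable def stepLaw : Measure (unitInterval × ℝ) :=
  (volume : Measure unitInterval).prod (expMeasure 1)

instance : IsProbabilityMeasure (expMeasure 1) := isProbabilityMeasure_expMeasure one_pos

instance : IsProbabilityMeasure stepLaw := by
  unfold stepLaw
  infer_instance

lemma noiseLaw_eq : noiseLaw = Measure.infinitePi fun _ : ℕ => stepLaw := rfl

/-- The noise after the first `n` coordinates have been removed. -/
def drop (n : ℕ) (w : Noise) : Noise := fun k => w (n + k)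

@[simp] lemma drop_apply (n k : ℕ) (w : Noise) : drop n w k = w (n + k) := rfl

@[simp] lemma drop_zero (w : Noise) : drop 0 w = w := by
  ext k <;> simp

lemma drop_drop (m n : ℕ) (w : Noise) : drop n (drop m w) = drop (m + n) w := by
  ext k <;> simp [add_assoc]

lemma measurable_drop (n : ℕ) : Measurable (drop n) :=
  measurable_pi_lambda _ fun k => measurable_pi_apply (n + k)

lemma measurable_drop_uncurry : Measurable fun q : ℕ × Noise => drop q.1 q.2 :=
  measurable_from_prod_countable_right fun n => measurable_drop n

lemma measurePreserving_drop (n : ℕ) : MeasurePreserving (drop n) noiseLaw noiseLaw := by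
  refine ⟨measurable_drop n, ?_⟩
  rw [noiseLaw_eq]
  exact Measure.map_infinitePi_infinitePi_of_inj (P := fun _ : ℕ => stepLaw)
    (f := fun k : ℕ => n + k) (add_right_injective n)

lemma measurePreserving_eval (n : ℕ) :
    MeasurePreserving (fun w : Noise => w n) noiseLaw stepLaw :=
  measurePreserving_eval_infinitePi (fun _ : ℕ => stepLaw) n

/-- The σ-algebra of the first `n` coordinates of the noise. -/
@[reducible]
def past (n : ℕ) : MeasurableSpace Noise :=
  ⨆ i ∈ Set.Iio n, MeasurableSpace.comap (fun w : Noise => w i) inferInstance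

/-- The σ-algebra of all coordinates of the noise but the first `n`. -/
@[reducible]
def future (n : ℕ) : MeasurableSpace Noise :=
  ⨆ i ∈ Set.Ici n, MeasurableSpace.comap (fun w : Noise => w i) inferInstance

lemma past_mono : Monotone past := fun _ _ h =>
  biSup_mono fun _ hi => lt_of_lt_of_le hi h

lemma past_le (n : ℕ) : past n ≤ (inferInstance : MeasurableSpace Noise) :=
  iSup₂_le fun i _ => (measurable_pi_apply i).comap_le

lemma iSup_past : ⨆ n, past n = (inferInstance : MeasurableSpace Noise) := by
  refine le_antisymm (iSup_le past_le) ?_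
  refine iSup_le fun i => ?_
  exact (le_biSup (fun j => MeasurableSpace.comap (fun w : Noise => w j) inferInstance)
    (Set.mem_Iio.2 i.lt_succ_self)).trans (le_iSup past (i + 1))

lemma measurable_eval_past {i n : ℕ} (h : i < n) : Measurable[past n] fun w : Noise => w i :=
  measurable_iff_comap_le.2 <|
    le_biSup (fun j => MeasurableSpace.comap (fun w : Noise => w j) inferInstance) (Set.mem_Iio.2 h)

lemma measurable_drop_future (n : ℕ) : Measurable[future n] (drop n) := by
  refine @measurable_pi_lambda _ _ _ (future n) _ _ fun k => ?_
  exact measurable_iff_comap_le.2 <|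
    le_biSup (fun j => MeasurableSpace.comap (fun w : Noise => w j) inferInstance)
      (Set.mem_Ici.2 (Nat.le_add_right n k))

lemma indep_past_future (n : ℕ) : Indep (past n) (future n) noiseLaw := by
  have h : iIndepFun (fun (i : ℕ) (w : Noise) => w i) noiseLaw :=
    iIndepFun_infinitePi (P := fun _ : ℕ => stepLaw) (X := fun _ x => x) fun _ => measurable_id
  refine indep_iSup_of_disjoint (fun i => (measurable_pi_apply i).comap_le) h.iIndep ?_
  exact Set.disjoint_left.2 fun i h1 h2 => absurd (Set.mem_Iio.1 h1) (not_lt.2 (Set.mem_Ici.1 h2))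

/-- The Markov property at a fixed step, which is later summed over the values of a hitting step. -/
lemma measure_inter_drop {n : ℕ} {B C : Set Noise} (hB : MeasurableSet[past n] B)
    (hC : MeasurableSet C) :
    noiseLaw (B ∩ drop n ⁻¹' C) = noiseLaw B * noiseLaw C := by
  rw [(Indep_iff _ _ _).1 (indep_past_future n) _ _ hB (measurable_drop_future n hC),
    (measurePreserving_drop n).measure_preimage hC.nullMeasurableSet]

/-- The first coordinate of the noise is independent of the others. -/
lemma measurePreserving_head_drop :
    MeasurePreserving (fun w : Noise => (w 0, drop 1 w)) noiseLaw (stepLaw.prod noiseLaw) := by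
  refine ⟨(measurable_pi_apply 0).prodMk (measurable_drop 1), ?_⟩
  have h : IndepFun (fun w : Noise => w 0) (drop 1) noiseLaw := by
    rw [IndepFun_iff_Indep]
    exact indep_of_indep_of_le_left (indep_of_indep_of_le_right (indep_past_future 1)
      (measurable_drop_future 1).comap_le) (measurable_eval_past Nat.zero_lt_one).comap_le
  rw [h.map_prod_eq_prod_map_map (measurable_pi_apply 0).aemeasurable
    (measurable_drop 1).aemeasurable, (measurePreserving_eval 0).map_eq,
    (measurePreserving_drop 1).map_eq]

lemma lintegral_noise_eq {F : (unitInterval × ℝ) × Noise → ENNReal} (hF : Measurable F) :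
    ∫⁻ w, F (w 0, drop 1 w) ∂noiseLaw = ∫⁻ s, ∫⁻ w, F (s, w) ∂noiseLaw ∂stepLaw := by
  rw [measurePreserving_head_drop.lintegral_comp hF, lintegral_prod _ hF.aemeasurable]

/-- Multiplying the `Gamma(1, 1)` density by `x` gives the `Gamma(2, 1)` density, which has total
mass one. -/
lemma lintegral_expMeasure_ofReal : ∫⁻ x, ENNReal.ofReal x ∂(expMeasure 1) = 1 := by
  have hm : Measurable (gammaPDF 1 1) := (measurable_gammaPDFReal 1 1).ennreal_ofReal
  have h1 : ∀ x : ℝ, (gammaPDF 1 1 * fun x => ENNReal.ofReal x) x = gammaPDF 2 1 x := by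
    intro x
    simp only [Pi.mul_apply, gammaPDF, gammaPDFReal]
    by_cases hx : 0 ≤ x
    · simp only [hx, if_true]
      rw [← ENNReal.ofReal_mul (by positivity)]
      congr 1
      rw [Real.Gamma_one, Real.Gamma_two]
      norm_num
      ring
    · simp [hx]
  rw [expMeasure, gammaMeasure, lintegral_withDensity_eq_lintegral_mul _ hm
    ENNReal.measurable_ofReal]
  simp_rw [h1]
  exact lintegral_gammaPDF_eq_one two_pos one_pos

lemma ae_expMeasure_nonneg : ∀ᵐ x ∂(expMeasure 1), 0 ≤ x := by
  have hm : Measurable (gammaPDF 1 1) := (measurable_gammaPDFReal 1 1).ennreal_ofReal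
  rw [expMeasure, gammaMeasure, ae_withDensity_iff hm]
  refine Eventually.of_forall fun x hx => ?_
  by_contra h
  exact hx (gammaPDF_of_neg (not_le.1 h))

lemma ae_noise_nonneg : ∀ᵐ w ∂noiseLaw, ∀ n, 0 ≤ (w n).2 := by
  refine ae_all_iff.2 fun n => ?_
  have h : MeasurePreserving (fun w : Noise => (w n).2) noiseLaw (expMeasure 1) :=
    (measurePreserving_snd (μ := (volume : Measure unitInterval)) (ν := expMeasure 1)).comp
      (measurePreserving_eval n)
  exact h.quasiMeasurePreserving.ae ae_expMeasure_nonneg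

/-- The uniform law has no atoms. This removes the ties that spoil the left-right symmetry of the
jump rule, which uses `≤`. -/
lemma ae_noise_ne (c : ℝ) (n : ℕ) : ∀ᵐ w ∂noiseLaw, ((w n).1 : ℝ) ≠ c := by
  have h : MeasurePreserving (fun w : Noise => (w n).1) noiseLaw volume :=
    (measurePreserving_fst (μ := (volume : Measure unitInterval)) (ν := expMeasure 1)).comp
      (measurePreserving_eval n)
  refine h.quasiMeasurePreserving.ae (p := fun γ : unitInterval => (γ : ℝ) ≠ c) ?_
  by_cases hc : c ∈ Set.Icc (0 : ℝ) 1
  · have : ∀ᵐ γ : unitInterval, γ ≠ ⟨c, hc⟩ := by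
      rw [ae_iff]
      simp
    filter_upwards [this] with γ hγ h'
    exact hγ (Subtype.ext h')
  · exact Eventually.of_forall fun γ h' => hc (h' ▸ γ.2)

end Noise

/-! ### The jump chain with general rates and first-step analysis. -/

section Chain

/-- The jump chain started at `x` with rates `a z` from `z` to `z - 1` and `b z` from `z` to
`z + 1`. -/
noncomputable def chainFrom (a b : ℤ → ℝ) (x : ℤ) (w : Noise) : ℕ → ℤ
  | 0 => x
  | n + 1 =>
    let y := chainFrom a b x w n
    if ((w n).1 : ℝ) ≤ b y / (a y + b y) then y + 1 else y - 1

variable {a b : ℤ → ℝ}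

@[simp] lemma chainFrom_zero (x : ℤ) (w : Noise) : chainFrom a b x w 0 = x := rfl

lemma chainFrom_succ (x : ℤ) (w : Noise) (n : ℕ) : chainFrom a b x w (n + 1) =
    if ((w n).1 : ℝ) ≤ b (chainFrom a b x w n) / (a (chainFrom a b x w n) + b (chainFrom a b x w n))
    then chainFrom a b x w n + 1 else chainFrom a b x w n - 1 := rfl

lemma chainFrom_add (x : ℤ) (w : Noise) (m n : ℕ) :
    chainFrom a b x w (m + n) = chainFrom a b (chainFrom a b x w m) (drop m w) n := by
  induction n with
  | zero => rfl
  | succ n ih => rw [← add_assoc, chainFrom_succ, chainFrom_succ, ih, drop_apply]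

lemma chainFrom_one_add (x : ℤ) (w : Noise) (n : ℕ) :
    chainFrom a b x w (n + 1) = chainFrom a b (chainFrom a b x w 1) (drop 1 w) n := by
  rw [add_comm, chainFrom_add]

lemma chainFrom_translate (x c : ℤ) (w : Noise) (n : ℕ) :
    chainFrom a b (x + c) w n =
      chainFrom (fun z => a (z + c)) (fun z => b (z + c)) x w n + c := by
  induction n with
  | zero => rfl
  | succ n ih =>
    rw [chainFrom_succ, chainFrom_succ, ih]
    split_ifs <;> ring

lemma chainFrom_succ_le (x : ℤ) (w : Noise) (n : ℕ) :
    chainFrom a b x w (n + 1) ≤ chainFrom a b x w n + 1 := by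
  rw [chainFrom_succ]
  split_ifs <;> linarith

lemma chainFrom_le (x : ℤ) (w : Noise) (n : ℕ) : chainFrom a b x w n ≤ x + n := by
  induction n with
  | zero => simp
  | succ n ih =>
    have := chainFrom_succ_le (a := a) (b := b) x w n
    push_cast
    linarith

lemma measurable_chainFrom_past (x : ℤ) (n : ℕ) :
    Measurable[past n] fun w => chainFrom a b x w n := by
  induction n with
  | zero => exact @measurable_const _ _ _ (past 0) x
  | succ n ih =>
    have h1 : Measurable[past (n + 1)] fun w => chainFrom a b x w n :=
      ih.mono (past_mono n.le_succ) le_rfl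
    have h2 : Measurable[past (n + 1)] fun w : Noise => ((w n).1 : ℝ) :=
      measurable_subtype_coe.comp (measurable_fst.comp (measurable_eval_past n.lt_succ_self))
    have h3 : Measurable fun z : ℤ => b z / (a z + b z) := measurable_from_top
    simp only [chainFrom_succ]
    refine Measurable.ite ?_ ?_ ?_
    · exact measurableSet_le h2 (h3.comp h1)
    · exact (measurable_from_top (f := fun z : ℤ => z + 1)).comp h1
    · exact (measurable_from_top (f := fun z : ℤ => z - 1)).comp h1

lemma measurable_chainFrom_past_of_le (x : ℤ) {m n : ℕ} (h : m ≤ n) :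
    Measurable[past n] fun w => chainFrom a b x w m :=
  (measurable_chainFrom_past x m).mono (past_mono h) le_rfl

lemma measurable_chainFrom (x : ℤ) (n : ℕ) : Measurable fun w => chainFrom a b x w n :=
  (measurable_chainFrom_past x n).mono (past_le n) le_rfl

/-- The probability of a jump to the right from `x`. -/
noncomputable def probRight (a b : ℤ → ℝ) (x : ℤ) : ENNReal := ENNReal.ofReal (b x / (a x + b x))

/-- The probability of a jump to the left from `x`. -/
noncomputable def probLeft (a b : ℤ → ℝ) (x : ℤ) : ENNReal := ENNReal.ofReal (a x / (a x + b x))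

/-- First step analysis. -/
lemma lintegral_first_step (ha : ∀ x, 0 < a x) (hb : ∀ x, 0 < b x) (x : ℤ)
    {G : ℤ → Noise → ENNReal} (hG : ∀ z, Measurable (G z)) :
    ∫⁻ w, G (chainFrom a b x w 1) (drop 1 w) ∂noiseLaw =
      probRight a b x * ∫⁻ w, G (x + 1) w ∂noiseLaw +
        probLeft a b x * ∫⁻ w, G (x - 1) w ∂noiseLaw := by
  have hax := ha x
  have hbx := hb x
  set p : ℝ := b x / (a x + b x) with hp
  have hp0 : 0 ≤ p := by positivity
  have hp1 : p ≤ 1 := by rw [hp, div_le_one (by positivity)]; linarith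
  set E : Set (unitInterval × ℝ) := {s | (s.1 : ℝ) ≤ p} with hE
  have hEm : MeasurableSet E :=
    measurableSet_le (measurable_subtype_coe.comp measurable_fst) measurable_const
  have hGm : Measurable fun q : ℤ × Noise => G q.1 q.2 :=
    measurable_from_prod_countable_right hG
  have hite : Measurable fun s : unitInterval × ℝ => if (s.1 : ℝ) ≤ p then x + 1 else x - 1 :=
    Measurable.ite hEm measurable_const measurable_const
  have h1 := lintegral_noise_eq (F := fun q => G (if (q.1.1 : ℝ) ≤ p then x + 1 else x - 1) q.2)
    (hGm.comp ((hite.comp measurable_fst).prodMk measurable_snd))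
  have h2 : ∀ w : Noise, chainFrom a b x w 1 = if ((w 0).1 : ℝ) ≤ p then x + 1 else x - 1 :=
    fun w => rfl
  simp only [h2]
  rw [h1]
  have h3 : ∀ s : unitInterval × ℝ,
      ∫⁻ w, G (if (s.1 : ℝ) ≤ p then x + 1 else x - 1) w ∂noiseLaw =
        E.indicator (fun _ => ∫⁻ w, G (x + 1) w ∂noiseLaw) s +
        Eᶜ.indicator (fun _ => ∫⁻ w, G (x - 1) w ∂noiseLaw) s := by
    intro s
    by_cases hs : (s.1 : ℝ) ≤ p
    · have hs' : s ∈ E := hs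
      simp [hs, hs']
    · have hs' : s ∉ E := hs
      simp [hs, hs']
  simp_rw [h3]
  have hEv : stepLaw E = probRight a b x := by
    have : E = (Set.Iic (⟨p, hp0, hp1⟩ : unitInterval)) ×ˢ Set.univ := by
      ext s
      simp [hE, ← Subtype.coe_le_coe]
    rw [this, stepLaw, Measure.prod_prod, unitInterval.volume_Iic]
    simp [probRight, hp]
  have hEc : stepLaw Eᶜ = probLeft a b x := by
    rw [prob_compl_eq_one_sub hEm, hEv, probRight, probLeft, ← ENNReal.ofReal_one,
      ← ENNReal.ofReal_sub _ hp0]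
    congr 1
    rw [hp, eq_comm, eq_sub_iff_add_eq, ← add_div, div_self (by positivity)]
  rw [lintegral_add_left (measurable_const.indicator hEm), lintegral_indicator_const hEm,
    lintegral_indicator_const hEm.compl, hEv, hEc]
  ring

lemma measure_first_step (ha : ∀ x, 0 < a x) (hb : ∀ x, 0 < b x) (x : ℤ)
    {A : ℤ → Set Noise} (hA : ∀ z, MeasurableSet (A z)) :
    noiseLaw {w | drop 1 w ∈ A (chainFrom a b x w 1)} =
      probRight a b x * noiseLaw (A (x + 1)) + probLeft a b x * noiseLaw (A (x - 1)) := by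
  have h := lintegral_first_step ha hb x (G := fun z => (A z).indicator 1)
    (fun z => measurable_one.indicator (hA z))
  simp only [lintegral_indicator_one (hA _)] at h
  rw [← h]
  have hm : MeasurableSet {w | drop 1 w ∈ A (chainFrom a b x w 1)} := by
    have hS : MeasurableSet {q : ℤ × Noise | q.2 ∈ A q.1} := by
      have : {q : ℤ × Noise | q.2 ∈ A q.1} = ⋃ z : ℤ, {z} ×ˢ A z := by
        ext q
        simp
      rw [this]
      exact MeasurableSet.iUnion fun z => (measurableSet_singleton z).prod (hA z)
    exact ((measurable_chainFrom x 1).prodMk (measurable_drop 1)) hS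
  rw [← lintegral_indicator_one hm]
  rfl

lemma toReal_probRight (ha : ∀ x, 0 < a x) (hb : ∀ x, 0 < b x) (x : ℤ) :
    (probRight a b x).toReal = b x / (a x + b x) := by
  have := ha x
  have := hb x
  exact ENNReal.toReal_ofReal (by positivity)

lemma toReal_probLeft (ha : ∀ x, 0 < a x) (hb : ∀ x, 0 < b x) (x : ℤ) :
    (probLeft a b x).toReal = a x / (a x + b x) := by
  have := ha x
  have := hb x
  exact ENNReal.toReal_ofReal (by positivity)

lemma probRight_add_probLeft (ha : ∀ x, 0 < a x) (hb : ∀ x, 0 < b x) (x : ℤ) :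
    probRight a b x + probLeft a b x = 1 := by
  have := ha x
  have := hb x
  rw [probRight, probLeft, ← ENNReal.ofReal_add (by positivity) (by positivity),
    ← ENNReal.ofReal_one]
  congr 1
  field_simp
  ring

end Chain

end RWRE

namespace RWRE

/-! ### Recurrence and transience criteria. -/

section Hitting

variable {a b : ℤ → ℝ}

lemma measurableSet_forall_chainFrom_ne (x y : ℤ) :
    MeasurableSet {w | ∀ n, chainFrom a b x w n ≠ y} := by
  rw [Set.ofPred_forall]
  exact MeasurableSet.iInter fun n => (measurable_chainFrom x n (measurableSet_singleton y)).compl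

lemma forall_chainFrom_ne_iff {x y : ℤ} (hxy : x ≠ y) (w : Noise) :
    (∀ n, chainFrom a b x w n ≠ y) ↔
      ∀ n, chainFrom a b (chainFrom a b x w 1) (drop 1 w) n ≠ y := by
  constructor
  · intro h n
    rw [← chainFrom_one_add]
    exact h _
  · rintro h (_ | n)
    · exact hxy
    · rw [chainFrom_one_add]
      exact h n

/-- A bounded nonnegative sequence `B` with `B 0 = 0`, the increments of which are proportional to
those of a divergent series, vanishes. -/
lemma eq_zero_of_increments {B c : ℕ → ℝ} (hB0 : B 0 = 0) (hB : ∀ m, 0 ≤ B m) (hB1 : ∀ m, B m ≤ 1)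
    (hc : ∀ m, B (m + 1) - B m = B 1 * c m) (hcpos : ∀ m, 0 ≤ c m) (hsum : ¬ Summable c) (m : ℕ) :
    B m = 0 := by
  have hs : ∀ m, B m = B 1 * ∑ j ∈ Finset.range m, c j := by
    intro m
    induction m with
    | zero => simp [hB0]
    | succ m ih => rw [Finset.sum_range_succ, mul_add, ← ih, ← hc m]; ring
  rcases (hB 1).eq_or_lt with h | h
  · rw [hs, ← h, zero_mul]
  · exfalso
    refine hsum (summable_of_sum_range_le (c := 1 / B 1) hcpos fun n => ?_)
    rw [le_div_iff₀ h, mul_comm, ← hs]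
    exact hB1 n

/-- If the backward sums of products of `b / a` diverge, then the chain almost surely hits every
site to the right of its starting point. -/
theorem ae_exists_chainFrom_eq (ha : ∀ x, 0 < a x) (hb : ∀ x, 0 < b x) (y : ℤ)
    (hdiv : ¬ Summable fun m => ∏ i ∈ Finset.range m, b (y - 1 - i) / a (y - 1 - i)) (m : ℕ) :
    ∀ᵐ w ∂noiseLaw, ∃ n, chainFrom a b (y - m) w n = y := by
  set A : ℤ → Set Noise := fun x => {w | ∀ n, chainFrom a b x w n ≠ y} with hA
  have hAm : ∀ x, MeasurableSet (A x) := fun x => measurableSet_forall_chainFrom_ne x y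
  -- `B m` is the probability that the chain started at `y - m` never visits `y`. The first-step
  -- equation makes each increment of `B` the previous one times `b / a`, so the increments are
  -- proportional to the terms of the divergent series.
  set B : ℕ → ℝ := fun m => (noiseLaw (A (y - m))).toReal with hB
  have hB0 : B 0 = 0 := by
    have : A (y - (0 : ℕ)) = ∅ := by
      ext w
      simp only [hA, Set.mem_ofPred_eq, Set.mem_empty_iff_false, iff_false, not_forall, not_not]
      exact ⟨0, by simp⟩
    simp only [hB]
    rw [this]
    simp
  have hstep : ∀ m : ℕ, B (m + 1) =
      b (y - 1 - m) / (a (y - 1 - m) + b (y - 1 - m)) * B m +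
      a (y - 1 - m) / (a (y - 1 - m) + b (y - 1 - m)) * B (m + 2) := by
    intro m
    have h := measure_first_step ha hb (y - 1 - m) hAm
    have h1 : {w | drop 1 w ∈ A (chainFrom a b (y - 1 - m) w 1)} = A (y - 1 - m) := by
      ext w
      exact (forall_chainFrom_ne_iff (by omega) w).symm
    rw [h1] at h
    have h2 := congrArg ENNReal.toReal h
    have e1 : y - 1 - (m : ℤ) = y - ((m + 1 : ℕ) : ℤ) := by push_cast; ring
    have e2 : y - 1 - (m : ℤ) + 1 = y - (m : ℤ) := by ring
    have e3 : y - 1 - (m : ℤ) - 1 = y - ((m + 2 : ℕ) : ℤ) := by push_cast; ring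
    rw [ENNReal.toReal_add (ENNReal.mul_ne_top (by simp [probRight]) (by simp))
      (ENNReal.mul_ne_top (by simp [probLeft]) (by simp)), ENNReal.toReal_mul, ENNReal.toReal_mul,
      toReal_probRight ha hb, toReal_probLeft ha hb, e2, e3] at h2
    simp only [hB]
    rw [← h2, e1]
  have hinc : ∀ m, B (m + 1) - B m =
      B 1 * ∏ i ∈ Finset.range m, b (y - 1 - i) / a (y - 1 - i) := by
    intro m
    induction m with
    | zero => simp [hB0]
    | succ m ih =>
      rw [Finset.prod_range_succ, ← mul_assoc, ← ih]
      have h := hstep m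
      have ha' := ha (y - 1 - m)
      have hb' := hb (y - 1 - m)
      have hab : a (y - 1 - m) + b (y - 1 - m) ≠ 0 := by positivity
      field_simp at h ⊢
      linarith
  have hzero := eq_zero_of_increments hB0 (fun m => ENNReal.toReal_nonneg)
    (fun m => by
      simp only [hB]
      rw [← ENNReal.toReal_one]
      exact ENNReal.toReal_mono ENNReal.one_ne_top prob_le_one) hinc
    (fun m => Finset.prod_nonneg fun i _ => (div_pos (hb _) (ha _)).le) hdiv m
  have : noiseLaw (A (y - m)) = 0 := by
    rcases (ENNReal.toReal_eq_zero_iff _).1 hzero with h | h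
    · exact h
    · exact absurd h (by simp)
  rw [ae_iff]
  convert this using 2
  ext w
  simp [hA]

/-- If the forward sums of products of `a / b` converge, then with positive probability the chain
started at `0` never hits `-1`. -/
theorem measure_exists_chainFrom_eq_neg_one_lt (ha : ∀ x, 0 < a x) (hb : ∀ x, 0 < b x)
    (hsum : Summable fun m => ∏ i ∈ Finset.range m, a i / b i) :
    noiseLaw {w | ∃ n, chainFrom a b 0 w n = -1} < 1 := by
  set c : ℕ → ℝ := fun m => ∏ i ∈ Finset.range m, a i / b i with hc
  have hcpos : ∀ m, 0 < c m := fun m => Finset.prod_pos fun i _ => div_pos (ha _) (hb _)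
  -- The tail `v m`, placed at the site `m - 1`, is harmonic at all sites `≥ 0`. Normalised by `v 0`
  -- it is `1` at `-1` and `v 1 / v 0 < 1` at `0`.
  set v : ℕ → ℝ := fun m => ∑' k, c (k + m) with hv
  have hsum' : ∀ m, Summable fun k => c (k + m) := fun m => (summable_nat_add_iff m).2 hsum
  have hvrec : ∀ m, v m = c m + v (m + 1) := fun m => by
    simp only [hv]
    rw [(hsum' m).tsum_eq_zero_add]
    simp only [zero_add]
    congr 1
    refine tsum_congr fun k => ?_
    congr 1
    ring
  have hvpos : ∀ m, 0 ≤ v m := fun m => tsum_nonneg fun k => (hcpos _).le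
  have hv1 : v 0 = 1 + v 1 := by rw [hvrec]; simp [hc]
  have hv0 : 0 < v 0 := by linarith [hvpos 1]
  set A : ℕ → ℤ → Set Noise := fun n x => {w | ∃ k ≤ n, chainFrom a b x w k = -1} with hA
  have hAm : ∀ n x, MeasurableSet (A n x) := fun n x => by
    have : A n x = ⋃ k ∈ Set.Iic n, (fun w => chainFrom a b x w k) ⁻¹' {-1} := by
      ext w
      simp [hA]
    rw [this]
    exact MeasurableSet.biUnion (Set.to_countable _) fun k _ =>
      measurable_chainFrom x k (measurableSet_singleton _)
  -- Limiting the chain to `n` steps allows induction on `n`, with the harmonic function as an upper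
  -- bound; no boundary condition at infinity is needed.
  have hbound : ∀ n m : ℕ, noiseLaw (A n (m - 1)) ≤ ENNReal.ofReal (v m / v 0) := by
    intro n
    induction n with
    | zero =>
      intro m
      rcases m with _ | m
      · rw [div_self hv0.ne', ENNReal.ofReal_one]
        exact prob_le_one
      · have : A 0 (((m + 1 : ℕ) : ℤ) - 1) = ∅ := by
          ext w
          simp [hA]
        rw [this]
        simp
    | succ n ih =>
      intro m
      rcases m with _ | m
      · rw [div_self hv0.ne', ENNReal.ofReal_one]
        exact prob_le_one
      · have e : ((m + 1 : ℕ) : ℤ) - 1 = m := by push_cast; ring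
        rw [e]
        have h1 : A (n + 1) m = {w | drop 1 w ∈ A n (chainFrom a b m w 1)} := by
          ext w
          simp only [hA, Set.mem_ofPred_eq]
          constructor
          · rintro ⟨_ | k, hk, h⟩
            · simp at h
            · exact ⟨k, by omega, by rw [← chainFrom_one_add]; exact h⟩
          · rintro ⟨k, hk, h⟩
            exact ⟨k + 1, by omega, by rw [chainFrom_one_add]; exact h⟩
        have h2 := ih m
        have h3 := ih (m + 2)
        have e3 : ((m + 2 : ℕ) : ℤ) - 1 = m + 1 := by push_cast; ring
        rw [e3] at h3
        rw [h1, measure_first_step ha hb _ (hAm n)]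
        have ha' := ha m
        have hb' := hb m
        have hvm := hvpos m
        have hvm2 := hvpos (m + 2)
        calc _ ≤ ENNReal.ofReal (b m / (a m + b m)) * ENNReal.ofReal (v (m + 2) / v 0) +
              ENNReal.ofReal (a m / (a m + b m)) * ENNReal.ofReal (v m / v 0) := by
              rw [probRight, probLeft]
              gcongr
          _ = ENNReal.ofReal (v (m + 1) / v 0) := by
            rw [← ENNReal.ofReal_mul (by positivity), ← ENNReal.ofReal_mul (by positivity),
              ← ENNReal.ofReal_add (by positivity) (by positivity)]
            congr 1
            have h4 : c (m + 1) = c m * (a m / b m) := by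
              simp only [hc]
              rw [Finset.prod_range_succ]
            have h5 := hvrec m
            have h6 := hvrec (m + 1)
            have hv0' := hv0.ne'
            have h7 : v (m + 2) = v (m + 1) - c m * (a m / b m) := by rw [← h4]; linarith
            have h8 : v m = v (m + 1) + c m := by linarith
            rw [h7, h8]
            field_simp
            ring
  have hU : {w | ∃ n, chainFrom a b 0 w n = -1} = ⋃ n, A n 0 := by
    ext w
    simp only [hA, Set.mem_ofPred_eq, Set.mem_iUnion]
    exact ⟨fun ⟨n, h⟩ => ⟨n, n, le_rfl, h⟩, fun ⟨_, k, _, h⟩ => ⟨k, h⟩⟩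
  have hmono : Monotone fun n => A n 0 := fun n n' h w ⟨k, hk, hw⟩ => ⟨k, hk.trans h, hw⟩
  rw [hU, hmono.measure_iUnion]
  refine lt_of_le_of_lt (iSup_le fun n => ?_ : _ ≤ ENNReal.ofReal (v 1 / v 0)) ?_
  · simpa using hbound n 1
  · rw [← ENNReal.ofReal_one]
    refine (ENNReal.ofReal_lt_ofReal_iff one_pos).2 ?_
    rw [div_lt_one hv0]
    linarith

end Hitting

/-! ### Quenched mean hitting times. -/

section HittingTime

variable {a b : ℤ → ℝ}

open Classical in
/-- The time spent on the `k`-th jump if the chain has not yet visited `y`, and `0` otherwise. -/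
noncomputable def holdingTime (a b : ℤ → ℝ) (x y : ℤ) (k : ℕ) (w : Noise) : ENNReal :=
  if ∀ j ≤ k, chainFrom a b x w j ≠ y then
    ENNReal.ofReal ((w k).2 / (a (chainFrom a b x w k) + b (chainFrom a b x w k)))
  else 0

/-- The total time before the first visit of `y`. -/
noncomputable def hittingTime (a b : ℤ → ℝ) (x y : ℤ) (w : Noise) : ENNReal :=
  ∑' k, holdingTime a b x y k w

lemma measurable_holdingTime (x y : ℤ) (k : ℕ) : Measurable (holdingTime a b x y k) := by
  classical
  refine Measurable.ite ?_ ?_ measurable_const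
  · have : {w : Noise | ∀ j ≤ k, chainFrom a b x w j ≠ y} =
        ⋂ j ∈ Set.Iic k, ((fun w => chainFrom a b x w j) ⁻¹' {y})ᶜ := by
      ext w
      simp
    rw [this]
    exact MeasurableSet.biInter (Set.to_countable _) fun j _ =>
      (measurable_chainFrom x j (measurableSet_singleton _)).compl
  · have h1 : Measurable fun z : ℤ => a z + b z := measurable_from_top
    exact ((measurable_snd.comp (measurable_pi_apply k)).div
      (h1.comp (measurable_chainFrom x k))).ennreal_ofReal

lemma holdingTime_self (y : ℤ) (k : ℕ) (w : Noise) : holdingTime a b y y k w = 0 := by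
  rw [holdingTime, if_neg]
  exact fun h => h 0 (Nat.zero_le _) rfl

lemma holdingTime_succ {x y : ℤ} (hxy : x ≠ y) (k : ℕ) (w : Noise) :
    holdingTime a b x y (k + 1) w = holdingTime a b (chainFrom a b x w 1) y k (drop 1 w) := by
  have h : (∀ j ≤ k + 1, chainFrom a b x w j ≠ y) ↔
      ∀ j ≤ k, chainFrom a b (chainFrom a b x w 1) (drop 1 w) j ≠ y := by
    constructor
    · intro h j hj
      rw [← chainFrom_one_add]
      exact h _ (by omega)
    · rintro h (_ | j) hj
      · exact hxy
      · rw [chainFrom_one_add]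
        exact h j (by omega)
  rw [holdingTime, holdingTime]
  have e := chainFrom_one_add (a := a) (b := b) x w k
  simp only [h, e, drop_apply, add_comm 1 k]

lemma lintegral_holdingTime_zero (ha : ∀ x, 0 < a x) (hb : ∀ x, 0 < b x) {x y : ℤ} (hxy : x ≠ y) :
    ∫⁻ w, holdingTime a b x y 0 w ∂noiseLaw = ENNReal.ofReal (1 / (a x + b x)) := by
  have hax := ha x
  have hbx := hb x
  have h1 : ∀ w : Noise, holdingTime a b x y 0 w =
      ENNReal.ofReal (1 / (a x + b x)) * ENNReal.ofReal (w 0).2 := by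
    intro w
    rw [holdingTime, if_pos (by simpa using hxy), ← ENNReal.ofReal_mul (by positivity)]
    congr 1
    simp only [chainFrom_zero]
    ring
  have hm : MeasurePreserving (fun w : Noise => (w 0).2) noiseLaw (expMeasure 1) :=
    (measurePreserving_snd (μ := (volume : Measure unitInterval)) (ν := expMeasure 1)).comp
      (measurePreserving_eval 0)
  simp_rw [h1]
  rw [lintegral_const_mul _ (by fun_prop), hm.lintegral_comp ENNReal.measurable_ofReal,
    lintegral_expMeasure_ofReal, mul_one]

lemma lintegral_holdingTime_succ (ha : ∀ x, 0 < a x) (hb : ∀ x, 0 < b x) {x y : ℤ} (hxy : x ≠ y)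
    (k : ℕ) : ∫⁻ w, holdingTime a b x y (k + 1) w ∂noiseLaw =
      probRight a b x * ∫⁻ w, holdingTime a b (x + 1) y k w ∂noiseLaw +
        probLeft a b x * ∫⁻ w, holdingTime a b (x - 1) y k w ∂noiseLaw := by
  simp_rw [holdingTime_succ hxy]
  exact lintegral_first_step ha hb x (G := fun z => holdingTime a b z y k)
    fun z => measurable_holdingTime z y k

/-- The quenched mean of the time to go from `x` to `x + 1`, as a series. -/
noncomputable def crossingSeries (a b : ℤ → ℝ) (x : ℤ) : ENNReal :=
  ∑' k : ℕ, ENNReal.ofReal (1 / b (x - k) * ∏ j ∈ Finset.range k, a (x - j) / b (x - j))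

lemma crossingSeries_rec (ha : ∀ x, 0 < a x) (hb : ∀ x, 0 < b x) (x : ℤ) :
    crossingSeries a b x =
      ENNReal.ofReal (1 / b x) + ENNReal.ofReal (a x / b x) * crossingSeries a b (x - 1) := by
  rw [crossingSeries, tsum_eq_zero_add' ENNReal.summable, crossingSeries, ← ENNReal.tsum_mul_left]
  congr 1
  · simp
  · refine tsum_congr fun k => ?_
    rw [← ENNReal.ofReal_mul (div_pos (ha x) (hb x)).le, Finset.prod_range_succ']
    congr 1
    have h : ∀ j : ℕ, x - ((j + 1 : ℕ) : ℤ) = x - 1 - j := fun j => by push_cast; ring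
    simp only [h]
    simp
    ring

/-- The first-step equation for crossing times, arranged so that no infinite terms are subtracted.
-/
lemma probRight_mul_crossingSeries (ha : ∀ x, 0 < a x) (hb : ∀ x, 0 < b x) (x : ℤ) :
    probRight a b x * crossingSeries a b x =
      ENNReal.ofReal (1 / (a x + b x)) + probLeft a b x * crossingSeries a b (x - 1) := by
  have hax := ha x
  have hbx := hb x
  rw [crossingSeries_rec ha hb, mul_add, ← mul_assoc, probRight, probLeft,
    ← ENNReal.ofReal_mul (by positivity), ← ENNReal.ofReal_mul (by positivity)]
  have e1 : b x / (a x + b x) * (1 / b x) = 1 / (a x + b x) := by field_simp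
  have e2 : b x / (a x + b x) * (a x / b x) = a x / (a x + b x) := by field_simp
  rw [e1, e2]

lemma lintegral_hittingTime (x y : ℤ) :
    ∫⁻ w, hittingTime a b x y w ∂noiseLaw = ∑' k, ∫⁻ w, holdingTime a b x y k w ∂noiseLaw :=
  lintegral_tsum fun k => (measurable_holdingTime x y k).aemeasurable

/-- The sums `G m` of crossing series solve the first-step equation for the mean time from `y - m`
to `y`. They therefore dominate the mean time spent in the first `n` steps, by induction on `n`.
Recurrence is not needed in this direction. -/
lemma lintegral_hittingTime_le (ha : ∀ x, 0 < a x) (hb : ∀ x, 0 < b x) (y : ℤ) :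
    ∫⁻ w, hittingTime a b (y - 1) y w ∂noiseLaw ≤ crossingSeries a b (y - 1) := by
  set S : ℕ → ENNReal := fun i => crossingSeries a b (y - 1 - i) with hS
  set G : ℕ → ENNReal := fun m => ∑ i ∈ Finset.range m, S i with hG
  have hmain : ∀ n m : ℕ,
      ∑ k ∈ Finset.range n, ∫⁻ w, holdingTime a b (y - m) y k w ∂noiseLaw ≤ G m := by
    intro n
    induction n with
    | zero => simp
    | succ n ih =>
      intro m
      rcases m with _ | m
      · simp [holdingTime_self]
      · have e1 : y - ((m + 1 : ℕ) : ℤ) = y - 1 - m := by push_cast; ring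
        have e2 : y - 1 - (m : ℤ) + 1 = y - (m : ℤ) := by ring
        have e3 : y - 1 - (m : ℤ) - 1 = y - ((m + 2 : ℕ) : ℤ) := by push_cast; ring
        have e4 : y - 1 - (m : ℤ) - 1 = y - 1 - ((m + 1 : ℕ) : ℤ) := by push_cast; ring
        have hne : y - 1 - (m : ℤ) ≠ y := by omega
        rw [e1, Finset.sum_range_succ', lintegral_holdingTime_zero ha hb hne]
        simp only [lintegral_holdingTime_succ ha hb hne]
        rw [Finset.sum_add_distrib, ← Finset.mul_sum, ← Finset.mul_sum, e2, e3]
        have hkey := probRight_mul_crossingSeries ha hb (y - 1 - m)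
        rw [e4] at hkey
        have hpq := probRight_add_probLeft ha hb (y - 1 - m)
        set p := probRight a b (y - 1 - m)
        set q := probLeft a b (y - 1 - m)
        calc _ ≤ p * G m + q * G (m + 2) + ENNReal.ofReal (1 / (a (y - 1 - m) + b (y - 1 - m))) := by
              gcongr
              · exact ih m
              · exact ih (m + 2)
          _ = (p + q) * G m + q * S m +
              (ENNReal.ofReal (1 / (a (y - 1 - m) + b (y - 1 - m))) + q * S (m + 1)) := by
              simp only [hG]
              rw [Finset.sum_range_succ, Finset.sum_range_succ]
              ring
          _ = (p + q) * G m + (p + q) * S m := by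
              simp only [hS]
              rw [← hkey]
              ring
          _ = G (m + 1) := by
              rw [hpq, one_mul, one_mul]
              simp only [hG]
              rw [Finset.sum_range_succ]
  rw [lintegral_hittingTime]
  refine ENNReal.tsum_le_of_sum_range_le fun n => ?_
  simpa [hG, hS] using hmain n 1

lemma lintegral_hittingTime_self (y : ℤ) : ∫⁻ w, hittingTime a b y y w ∂noiseLaw = 0 := by
  simp [lintegral_hittingTime, holdingTime_self]

lemma lintegral_hittingTime_rec (ha : ∀ x, 0 < a x) (hb : ∀ x, 0 < b x) {x y : ℤ} (hxy : x ≠ y) :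
    ∫⁻ w, hittingTime a b x y w ∂noiseLaw = ENNReal.ofReal (1 / (a x + b x)) +
      (probRight a b x * ∫⁻ w, hittingTime a b (x + 1) y w ∂noiseLaw +
        probLeft a b x * ∫⁻ w, hittingTime a b (x - 1) y w ∂noiseLaw) := by
  simp only [lintegral_hittingTime]
  rw [tsum_eq_zero_add' ENNReal.summable, lintegral_holdingTime_zero ha hb hxy]
  simp only [lintegral_holdingTime_succ ha hb hxy]
  rw [ENNReal.tsum_add, ENNReal.tsum_mul_left, ENNReal.tsum_mul_left]

/-- If the backward sums of products of `b / a` diverge, then the mean time to go from `y - 1` to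
`y` is at least the crossing series. -/
lemma crossingSeries_le (ha : ∀ x, 0 < a x) (hb : ∀ x, 0 < b x) (y : ℤ)
    (hdiv : ∀ y : ℤ, ¬ Summable fun m => ∏ i ∈ Finset.range m, b (y - i) / a (y - i)) :
    crossingSeries a b (y - 1) ≤ ∫⁻ w, hittingTime a b (y - 1) y w ∂noiseLaw := by
  set H : ℕ → ENNReal := fun m => ∫⁻ w, hittingTime a b (y - m) y w ∂noiseLaw with hH
  by_cases htop : ∫⁻ w, hittingTime a b (y - 1) y w ∂noiseLaw = ⊤
  · rw [htop]
    exact le_top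
  have hH0 : H 0 = 0 := by simp [hH, lintegral_hittingTime_self]
  have hrec : ∀ m : ℕ, H (m + 1) = ENNReal.ofReal (1 / (a (y - 1 - m) + b (y - 1 - m))) +
      (probRight a b (y - 1 - m) * H m + probLeft a b (y - 1 - m) * H (m + 2)) := by
    intro m
    have h := lintegral_hittingTime_rec ha hb (x := y - 1 - m) (y := y) (by omega)
    have e1 : y - 1 - (m : ℤ) = y - ((m + 1 : ℕ) : ℤ) := by push_cast; ring
    have e2 : y - 1 - (m : ℤ) + 1 = y - (m : ℤ) := by ring
    have e3 : y - 1 - (m : ℤ) - 1 = y - ((m + 2 : ℕ) : ℤ) := by push_cast; ring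
    rw [e2, e3] at h
    simp only [hH]
    rw [← h, e1]
  -- Finiteness spreads to the left, because each site has a positive probability of a jump to the
  -- left.
  have hfin : ∀ m, H m ≠ ⊤ ∧ H (m + 1) ≠ ⊤ := by
    intro m
    induction m with
    | zero => exact ⟨by simp [hH0], by simpa [hH] using htop⟩
    | succ m ih =>
      refine ⟨ih.2, fun h => ih.2 ?_⟩
      rw [hrec, h, ENNReal.mul_top]
      · simp
      · have := ha (y - 1 - m)
        have := hb (y - 1 - m)
        simp only [probLeft, ne_eq, ENNReal.ofReal_eq_zero, not_le]
        positivity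
  set h : ℕ → ℝ := fun m => (H m).toReal with hh
  -- `d m` plays the role of the mean time from `y - m - 1` to `y - m`; the first-step equation
  -- turns into a first-order recursion for it.
  set d : ℕ → ℝ := fun m => h (m + 1) - h m with hd
  have hdrec : ∀ m : ℕ, d m = 1 / b (y - 1 - m) + a (y - 1 - m) / b (y - 1 - m) * d (m + 1) := by
    intro m
    have ha' := ha (y - 1 - m)
    have hb' := hb (y - 1 - m)
    have h1 := congrArg ENNReal.toReal (hrec m)
    have hR : probRight a b (y - 1 - m) * H m ≠ ⊤ :=
      ENNReal.mul_ne_top (by simp [probRight]) (hfin m).1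
    have hL : probLeft a b (y - 1 - m) * H (m + 2) ≠ ⊤ :=
      ENNReal.mul_ne_top (by simp [probLeft]) (hfin (m + 1)).2
    rw [ENNReal.toReal_add (by simp) (ENNReal.add_ne_top.2 ⟨hR, hL⟩), ENNReal.toReal_add hR hL,
      ENNReal.toReal_mul, ENNReal.toReal_mul, toReal_probRight ha hb, toReal_probLeft ha hb,
      ENNReal.toReal_ofReal (by positivity)] at h1
    have h2 : h (m + 1) = 1 / (a (y - 1 - m) + b (y - 1 - m)) +
      (b (y - 1 - m) / (a (y - 1 - m) + b (y - 1 - m)) * h m +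
       a (y - 1 - m) / (a (y - 1 - m) + b (y - 1 - m)) * h (m + 2)) := h1
    simp only [hd]
    field_simp at h2 ⊢
    linarith
  -- A negative `d m` would propagate: `d (m + k) ≤ d m * c k` with `c` not summable, so `h` would
  -- fall to minus infinity although it is nonnegative.
  have hdnn : ∀ m, 0 ≤ d m := by
    intro m
    by_contra hneg
    rw [not_le] at hneg
    set c : ℕ → ℝ := fun k => ∏ i ∈ Finset.range k, b (y - 1 - m - i) / a (y - 1 - m - i) with hc
    have hcpos : ∀ k, 0 ≤ c k := fun k =>
      Finset.prod_nonneg fun i _ => (div_pos (hb _) (ha _)).le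
    have hdk : ∀ k, d (m + k) ≤ d m * c k := by
      intro k
      induction k with
      | zero => simp [hc]
      | succ k ih =>
        have e : y - 1 - ((m + k : ℕ) : ℤ) = y - 1 - m - k := by push_cast; ring
        have h1 := hdrec (m + k)
        rw [e] at h1
        have ha' := ha (y - 1 - m - k)
        have hb' := hb (y - 1 - m - k)
        have h2 : d (m + (k + 1)) = b (y - 1 - m - k) / a (y - 1 - m - k) *
            (d (m + k) - 1 / b (y - 1 - m - k)) := by
          rw [h1]
          field_simp
          ring_nf
        have h3 : c (k + 1) = c k * (b (y - 1 - m - k) / a (y - 1 - m - k)) := by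
          simp only [hc]
          rw [Finset.prod_range_succ]
        rw [h2, h3, ← mul_assoc, mul_comm]
        gcongr
        have : 0 < 1 / b (y - 1 - m - k) := by positivity
        linarith
    refine hdiv (y - 1 - m) (summable_of_sum_range_le (c := h m / (- d m)) hcpos fun n => ?_)
    have hsum : h (m + n) ≤ h m + d m * ∑ k ∈ Finset.range n, c k := by
      induction n with
      | zero => simp
      | succ n ih =>
        rw [Finset.sum_range_succ, mul_add]
        have := hdk n
        simp only [hd] at this ih ⊢
        rw [← add_assoc]
        linarith
    have hnn : 0 ≤ h (m + n) := ENNReal.toReal_nonneg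
    rw [le_div_iff₀ (by linarith)]
    linarith
  -- Iterating the recursion leaves a partial sum of the crossing series plus a remainder, which is
  -- nonnegative and can be dropped.
  have hpart : ∀ n : ℕ, d 0 = (∑ k ∈ Finset.range n, 1 / b (y - 1 - k) *
      ∏ j ∈ Finset.range k, a (y - 1 - j) / b (y - 1 - j)) +
      (∏ j ∈ Finset.range n, a (y - 1 - j) / b (y - 1 - j)) * d n := by
    intro n
    induction n with
    | zero => simp
    | succ n ih =>
      rw [ih, hdrec n, Finset.sum_range_succ, Finset.prod_range_succ]
      ring
  have hd0 : ENNReal.ofReal (d 0) = ∫⁻ w, hittingTime a b (y - 1) y w ∂noiseLaw := by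
    simp only [hd, hh, hH0]
    simp [hH, htop]
  rw [← hd0, crossingSeries]
  have hterm : ∀ k : ℕ, 0 ≤ 1 / b (y - 1 - k) *
      ∏ j ∈ Finset.range k, a (y - 1 - j) / b (y - 1 - j) := fun k =>
    mul_nonneg (one_div_pos.2 (hb _)).le (Finset.prod_nonneg fun j _ => (div_pos (ha _) (hb _)).le)
  refine ENNReal.tsum_le_of_sum_range_le fun n => ?_
  rw [← ENNReal.ofReal_sum_of_nonneg fun k _ => hterm k]
  refine ENNReal.ofReal_le_ofReal ?_
  rw [hpart n]
  have : 0 ≤ (∏ j ∈ Finset.range n, a (y - 1 - j) / b (y - 1 - j)) * d n :=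
    mul_nonneg (Finset.prod_nonneg fun j _ => (div_pos (ha _) (hb _)).le) (hdnn n)
  linarith

end HittingTime

end RWRE

namespace RWRE

/-! ### First visits and the strong Markov property. -/

section HitStep

variable {a b : ℤ → ℝ}

/-- The number of steps before the first visit of `y` (`0` if `y` is never visited). -/
noncomputable def hitStep (a b : ℤ → ℝ) (x y : ℤ) (w : Noise) : ℕ :=
  sInf {n | chainFrom a b x w n = y}

lemma chainFrom_hitStep {x y : ℤ} {w : Noise} (h : ∃ n, chainFrom a b x w n = y) :
    chainFrom a b x w (hitStep a b x y w) = y :=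
  Nat.sInf_mem (s := {n | chainFrom a b x w n = y}) h

lemma hitStep_le {x y : ℤ} {w : Noise} {n : ℕ} (h : chainFrom a b x w n = y) :
    hitStep a b x y w ≤ n :=
  Nat.sInf_le h

lemma chainFrom_ne_of_lt_hitStep {x y : ℤ} {w : Noise} {n : ℕ} (h : n < hitStep a b x y w) :
    chainFrom a b x w n ≠ y := fun h' => absurd (hitStep_le h') (not_le.2 h)

lemma hitStep_self (y : ℤ) (w : Noise) : hitStep a b y y w = 0 :=
  Nat.le_zero.1 (hitStep_le rfl)

lemma hitStep_eq_iff {x y : ℤ} {w : Noise} (h : ∃ n, chainFrom a b x w n = y) (k : ℕ) :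
    hitStep a b x y w = k ↔ chainFrom a b x w k = y ∧ ∀ j < k, chainFrom a b x w j ≠ y := by
  constructor
  · rintro rfl
    exact ⟨chainFrom_hitStep h, fun j hj => chainFrom_ne_of_lt_hitStep hj⟩
  · rintro ⟨h1, h2⟩
    refine le_antisymm (hitStep_le h1) ?_
    by_contra h3
    exact h2 _ (not_le.1 h3) (chainFrom_hitStep h)

lemma hitStep_translate (x y c : ℤ) (w : Noise) :
    hitStep a b (x + c) (y + c) w =
      hitStep (fun z => a (z + c)) (fun z => b (z + c)) x y w := by
  simp only [hitStep, chainFrom_translate, add_left_inj]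

lemma chainFrom_lt_of_forall_ne {x y : ℤ} {w : Noise} {n : ℕ} (hxy : x ≤ y)
    (h : ∀ j ≤ n, chainFrom a b x w j ≠ y) : chainFrom a b x w n < y := by
  induction n with
  | zero => exact lt_of_le_of_ne hxy (h 0 le_rfl)
  | succ n ih =>
    have h1 := ih fun j hj => h j (by omega)
    have h2 := chainFrom_succ_le (a := a) (b := b) x w n
    have h3 := h (n + 1) le_rfl
    omega

lemma chainFrom_lt_of_lt_hitStep {x y : ℤ} {w : Noise} {n : ℕ} (hxy : x ≤ y)
    (h : n < hitStep a b x y w) : chainFrom a b x w n < y :=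
  chainFrom_lt_of_forall_ne hxy fun _ hj => chainFrom_ne_of_lt_hitStep (lt_of_le_of_lt hj h)

lemma hitStep_le_hitStep_add_one {x y : ℤ} {w : Noise} (hxy : x ≤ y)
    (h1 : ∃ n, chainFrom a b x w n = y + 1) :
    hitStep a b x y w ≤ hitStep a b x (y + 1) w := by
  by_contra h
  have h2 := chainFrom_lt_of_lt_hitStep hxy (not_le.1 h)
  rw [chainFrom_hitStep h1] at h2
  omega

lemma exists_chainFrom_drop_eq {x y : ℤ} {w : Noise} (hxy : x ≤ y)
    (h0 : ∃ n, chainFrom a b x w n = y) (h1 : ∃ n, chainFrom a b x w n = y + 1) :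
    chainFrom a b y (drop (hitStep a b x y w) w)
      (hitStep a b x (y + 1) w - hitStep a b x y w) = y + 1 := by
  have h2 := chainFrom_add (a := a) (b := b) x w (hitStep a b x y w)
    (hitStep a b x (y + 1) w - hitStep a b x y w)
  rw [chainFrom_hitStep h0, Nat.add_sub_cancel' (hitStep_le_hitStep_add_one hxy h1),
    chainFrom_hitStep h1] at h2
  exact h2.symm

/-- The chain rises by at most one per step, so it meets `y` before `y + 1`, and its path to `y + 1`
splits at the first visit of `y`. -/
lemma hitStep_add_one {x y : ℤ} {w : Noise} (hxy : x ≤ y)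
    (h0 : ∃ n, chainFrom a b x w n = y) (h1 : ∃ n, chainFrom a b x w n = y + 1) :
    hitStep a b x (y + 1) w =
      hitStep a b x y w + hitStep a b y (y + 1) (drop (hitStep a b x y w) w) := by
  have h3 := exists_chainFrom_drop_eq hxy h0 h1
  have h4 := hitStep_le_hitStep_add_one hxy h1
  refine le_antisymm (hitStep_le ?_) ?_
  · rw [chainFrom_add, chainFrom_hitStep h0]
    exact chainFrom_hitStep ⟨_, h3⟩
  · have := hitStep_le h3
    omega

lemma measurableSet_past_first_hit (x y : ℤ) (k : ℕ) :
    MeasurableSet[past k] {w | chainFrom a b x w k = y ∧ ∀ j < k, chainFrom a b x w j ≠ y} := by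
  have h : {w | chainFrom a b x w k = y ∧ ∀ j < k, chainFrom a b x w j ≠ y} =
      (fun w => chainFrom a b x w k) ⁻¹' {y} ∩
        ⋂ j ∈ Set.Iio k, (fun w => chainFrom a b x w j) ⁻¹' {y}ᶜ := by
    ext w
    simp
  rw [h]
  refine MeasurableSet.inter (measurable_chainFrom_past x k (measurableSet_singleton y)) ?_
  exact MeasurableSet.biInter (Set.to_countable _) fun j hj =>
    measurable_chainFrom_past_of_le x (le_of_lt hj) (measurableSet_singleton y).compl

/-- The strong Markov property of the noise at the first visit of `y`. -/
theorem measure_inter_drop_hitStep {x y : ℤ} (hhit : ∀ᵐ w ∂noiseLaw, ∃ n, chainFrom a b x w n = y)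
    {m : ℕ} (hm : ∀ w n, chainFrom a b x w n = y → m ≤ n) {B C : Set Noise}
    (hB : MeasurableSet[past m] B) (hC : MeasurableSet C) :
    noiseLaw (B ∩ {w | drop (hitStep a b x y w) w ∈ C}) = noiseLaw B * noiseLaw C := by
  set E : ℕ → Set Noise :=
    fun k => {w | chainFrom a b x w k = y ∧ ∀ j < k, chainFrom a b x w j ≠ y} with hE
  have hEp : ∀ k, MeasurableSet[past k] (E k) := measurableSet_past_first_hit x y
  have hEm : ∀ k, MeasurableSet (E k) := fun k => past_le k _ (hEp k)
  have hBm : MeasurableSet B := past_le m _ hB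
  have hdisj : Pairwise (Function.onFun Disjoint E) := by
    intro k k' hne
    refine Set.disjoint_left.2 fun w h1 h2 => hne ?_
    rw [← (hitStep_eq_iff ⟨k, h1.1⟩ k).2 h1, ← (hitStep_eq_iff ⟨k, h1.1⟩ k').2 h2]
  -- `B` only needs to be known by step `k` when `k ≥ m`; by `hm` there are no first visits before
  -- step `m`.
  have hBE : ∀ k, MeasurableSet[past k] (B ∩ E k) := by
    intro k
    rcases le_or_gt m k with h | h
    · exact MeasurableSet.inter (past_mono h _ hB) (hEp k)
    · have : B ∩ E k = ∅ := by
        refine Set.eq_empty_of_forall_notMem fun w hw => ?_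
        exact absurd (hm w k hw.2.1) (not_le.2 h)
      rw [this]
      exact @MeasurableSet.empty _ (past k)
  have h1 : (B ∩ {w | drop (hitStep a b x y w) w ∈ C} : Set Noise) =ᵐ[noiseLaw]
      ⋃ k, (B ∩ E k) ∩ drop k ⁻¹' C := by
    filter_upwards [hhit] with w hw
    refine propext ?_
    change (w ∈ B ∧ drop (hitStep a b x y w) w ∈ C) ↔ w ∈ ⋃ k, (B ∩ E k) ∩ drop k ⁻¹' C
    simp only [Set.mem_iUnion, Set.mem_inter_iff, Set.mem_preimage]
    constructor
    · rintro ⟨hb, hc⟩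
      exact ⟨_, ⟨hb, (hitStep_eq_iff hw _).1 rfl⟩, hc⟩
    · rintro ⟨k, ⟨hb, he⟩, hc⟩
      rw [(hitStep_eq_iff hw k).2 he]
      exact ⟨hb, hc⟩
  have h2 : B =ᵐ[noiseLaw] ⋃ k, (B ∩ E k) := by
    filter_upwards [hhit] with w hw
    refine propext ?_
    change w ∈ B ↔ w ∈ ⋃ k, (B ∩ E k)
    simp only [Set.mem_iUnion, Set.mem_inter_iff]
    exact ⟨fun hb => ⟨_, hb, (hitStep_eq_iff hw _).1 rfl⟩, fun ⟨_, hb, _⟩ => hb⟩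
  have hd1 : Pairwise (Function.onFun Disjoint fun k => B ∩ E k) := fun k k' hne =>
    (hdisj hne).mono Set.inter_subset_right Set.inter_subset_right
  have hd2 : Pairwise (Function.onFun Disjoint fun k => (B ∩ E k) ∩ drop k ⁻¹' C) :=
    fun k k' hne => (hd1 hne).mono Set.inter_subset_left Set.inter_subset_left
  rw [measure_congr h1, measure_congr h2,
    measure_iUnion hd2 fun k => (hBm.inter (hEm k)).inter (measurable_drop k hC),
    measure_iUnion hd1 fun k => hBm.inter (hEm k), ← ENNReal.tsum_mul_right]
  exact tsum_congr fun k => measure_inter_drop (hBE k) hC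

lemma measurable_hitStep (x y : ℤ) : Measurable (hitStep a b x y) := by
  classical
  have h0 : MeasurableSet {w : Noise | ∃ n, chainFrom a b x w n = y} := by
    rw [Set.ofPred_exists]
    exact MeasurableSet.iUnion fun n => measurable_chainFrom x n (measurableSet_singleton y)
  refine measurable_to_countable' fun k => ?_
  have h1 : hitStep a b x y ⁻¹' {k} =
      ({w | ∃ n, chainFrom a b x w n = y} ∩
        {w | chainFrom a b x w k = y ∧ ∀ j < k, chainFrom a b x w j ≠ y}) ∪
      ({w | ∃ n, chainFrom a b x w n = y}ᶜ ∩ {_w | k = 0}) := by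
    ext w
    simp only [Set.mem_preimage, Set.mem_singleton_iff, Set.mem_union, Set.mem_inter_iff,
      Set.mem_ofPred_eq, Set.mem_compl_iff]
    by_cases h : ∃ n, chainFrom a b x w n = y
    · rw [hitStep_eq_iff h]
      tauto
    · have : hitStep a b x y w = 0 := by
        rw [hitStep, Nat.sInf_eq_zero]
        right
        exact Set.eq_empty_of_forall_notMem fun n hn => h ⟨n, hn⟩
      rw [this]
      constructor
      · rintro rfl
        exact Or.inr ⟨h, rfl⟩
      · rintro (⟨h1, _⟩ | ⟨_, h1⟩)
        · exact absurd h1 h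
        · exact h1.symm
  rw [h1]
  exact (h0.inter (past_le k _ (measurableSet_past_first_hit x y k))).union
    (h0.compl.inter (MeasurableSet.const _))

lemma map_drop_hitStep {x y : ℤ} (hhit : ∀ᵐ w ∂noiseLaw, ∃ n, chainFrom a b x w n = y) :
    noiseLaw.map (fun w => drop (hitStep a b x y w) w) = noiseLaw := by
  have hmeas : Measurable fun w => drop (hitStep a b x y w) w :=
    measurable_drop_uncurry.comp ((measurable_hitStep x y).prodMk measurable_id)
  ext C hC
  rw [Measure.map_apply hmeas hC]
  have h := measure_inter_drop_hitStep hhit (m := 0) (fun _ n _ => n.zero_le)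
    (B := Set.univ) MeasurableSet.univ hC
  rw [Set.univ_inter, measure_univ, one_mul] at h
  exact h

end HitStep

/-! ### The ladder map and its ergodicity. -/

section Ladder

variable {l : ℝ} {ξ : Env}

lemma rMinusBiased_pos (l : ℝ) (ξ : Env) (x : ℤ) : 0 < rMinusBiased l ξ x :=
  mul_pos (ξ x).1.2 (Real.exp_pos _)

lemma rPlusBiased_pos (l : ℝ) (ξ : Env) (x : ℤ) : 0 < rPlusBiased l ξ x :=
  mul_pos (ξ x).2.2 (Real.exp_pos _)

lemma totalRate_pos (l : ℝ) (ξ : Env) (x : ℤ) : 0 < totalRate l ξ x :=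
  add_pos (rMinusBiased_pos l ξ x) (rPlusBiased_pos l ξ x)

lemma jumpChain_eq_chainFrom (l : ℝ) (ξ : Env) (w : Noise) (n : ℕ) :
    jumpChain l ξ w n = chainFrom (rMinusBiased l ξ) (rPlusBiased l ξ) 0 w n := by
  induction n with
  | zero => rfl
  | succ n ih =>
    rw [chainFrom_succ, ← ih]
    rfl

lemma shift_iterate_apply (n : ℕ) (ξ : Env) (x : ℤ) : (shift^[n] ξ) x = ξ (x + n) := by
  induction n generalizing x with
  | zero => simp
  | succ n ih =>
    rw [Function.iterate_succ_apply', shift, ih]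
    congr 1
    push_cast
    ring

lemma rMinusBiased_shift_iterate (n : ℕ) (x : ℤ) :
    rMinusBiased l (shift^[n] ξ) x = rMinusBiased l ξ (x + n) := by
  simp [rMinusBiased, rMinus, shift_iterate_apply]

lemma rPlusBiased_shift_iterate (n : ℕ) (x : ℤ) :
    rPlusBiased l (shift^[n] ξ) x = rPlusBiased l ξ (x + n) := by
  simp [rPlusBiased, rPlus, shift_iterate_apply]

lemma totalRate_shift_iterate (n : ℕ) (x : ℤ) :
    totalRate l (shift^[n] ξ) x = totalRate l ξ (x + n) := by
  simp [totalRate, rMinusBiased_shift_iterate, rPlusBiased_shift_iterate]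

/-- The first step at which the jump chain visits `n`. -/
noncomputable def ladderStep (l : ℝ) (ξ : Env) (n : ℕ) (w : Noise) : ℕ :=
  hitStep (rMinusBiased l ξ) (rPlusBiased l ξ) 0 n w

/-- The environment seen from the first visit of `1`, and the noise not yet used then. -/
noncomputable def ladder (l : ℝ) (q : Env × Noise) : Env × Noise :=
  (shift q.1, drop (ladderStep l q.1 1 q.2) q.2)

/-- The jump chain visits every nonnegative integer. -/
def HitsAll (l : ℝ) (ξ : Env) (w : Noise) : Prop := ∀ y : ℕ, ∃ n, jumpChain l ξ w n = y

lemma HitsAll.chainFrom {w : Noise} (h : HitsAll l ξ w) (y : ℕ) :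
    ∃ n, chainFrom (rMinusBiased l ξ) (rPlusBiased l ξ) 0 w n = y := by
  simpa only [jumpChain_eq_chainFrom] using h y

lemma jumpChain_ladderStep {w : Noise} (h : HitsAll l ξ w) (n : ℕ) :
    jumpChain l ξ w (ladderStep l ξ n w) = n := by
  rw [jumpChain_eq_chainFrom]
  exact chainFrom_hitStep (h.chainFrom n)

lemma ladderStep_zero (w : Noise) : ladderStep l ξ 0 w = 0 := hitStep_self 0 w

lemma hitStep_shift (n : ℕ) (w : Noise) :
    hitStep (rMinusBiased l ξ) (rPlusBiased l ξ) n (n + 1) w = ladderStep l (shift^[n] ξ) 1 w := by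
  have h := hitStep_translate (a := rMinusBiased l ξ) (b := rPlusBiased l ξ) 0 1 n w
  rw [zero_add, add_comm (1 : ℤ)] at h
  rw [h, ladderStep]
  congr 1
  · ext z
    rw [rMinusBiased_shift_iterate]
  · ext z
    rw [rPlusBiased_shift_iterate]

lemma ladderStep_succ {w : Noise} (h : HitsAll l ξ w) (n : ℕ) :
    ladderStep l ξ (n + 1) w = ladderStep l ξ n w +
      ladderStep l (shift^[n] ξ) 1 (drop (ladderStep l ξ n w) w) := by
  have h1 := h.chainFrom (n + 1)
  rw [Nat.cast_add_one] at h1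
  have h2 := hitStep_add_one (Int.natCast_nonneg n) (h.chainFrom n) h1
  rw [hitStep_shift] at h2
  rw [ladderStep, ladderStep, Nat.cast_add_one, h2]

lemma ladder_iterate {w : Noise} (h : HitsAll l ξ w) (n : ℕ) :
    (ladder l)^[n] (ξ, w) = (shift^[n] ξ, drop (ladderStep l ξ n w) w) := by
  induction n with
  | zero => simp [ladderStep_zero]
  | succ n ih =>
    rw [Function.iterate_succ_apply', ih, ladder, Function.iterate_succ_apply', drop_drop,
      ladderStep_succ h]

lemma jumpChain_add_ladderStep {w : Noise} (h : HitsAll l ξ w) (n k : ℕ) :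
    jumpChain l ξ w (ladderStep l ξ n w + k) =
      n + jumpChain l ((ladder l)^[n] (ξ, w)).1 ((ladder l)^[n] (ξ, w)).2 k := by
  rw [ladder_iterate h, jumpChain_eq_chainFrom, chainFrom_add, ← jumpChain_eq_chainFrom,
    jumpChain_ladderStep h, jumpChain_eq_chainFrom]
  have h1 := chainFrom_translate (a := rMinusBiased l ξ) (b := rPlusBiased l ξ) 0 n
    (drop (ladderStep l ξ n w) w) k
  rw [zero_add] at h1
  rw [h1, add_comm]
  congr 2
  · ext z
    rw [rMinusBiased_shift_iterate]
  · ext z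
    rw [rPlusBiased_shift_iterate]

lemma jumpTime_add (w : Noise) (m k : ℕ) :
    jumpTime l ξ w (m + k) = jumpTime l ξ w m +
      ∑ j ∈ Finset.range k, (w (m + j)).2 / totalRate l ξ (jumpChain l ξ w (m + j)) := by
  simp only [jumpTime]
  rw [Finset.sum_range_add]

/-- The time of the first visit of `1`. -/
noncomputable def ladderTime (l : ℝ) (q : Env × Noise) : ℝ :=
  jumpTime l q.1 q.2 (ladderStep l q.1 1 q.2)

/-- This brings first-visit times within reach of the ergodic theorem: successive crossing times are
one function evaluated along an orbit. -/
lemma jumpTime_ladderStep {w : Noise} (h : HitsAll l ξ w) (n : ℕ) :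
    jumpTime l ξ w (ladderStep l ξ n w) = birkhoffSum (ladder l) (ladderTime l) n (ξ, w) := by
  induction n with
  | zero => simp [ladderStep_zero, jumpTime]
  | succ n ih =>
    rw [birkhoffSum_succ, ← ih, ladderStep_succ h, jumpTime_add, add_right_inj]
    simp only [jumpChain_add_ladderStep h]
    rw [ladder_iterate h, ladderTime, jumpTime]
    refine Finset.sum_congr rfl fun j _ => ?_
    dsimp only
    rw [drop_apply, totalRate_shift_iterate, add_comm (n : ℤ)]

/-- The backward sums of products of `r^+ / r^-` diverge. -/
def Backward (l : ℝ) (ξ : Env) : Prop := ∀ y : ℤ,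
  ¬ Summable fun m => ∏ i ∈ Finset.range m, rPlusBiased l ξ (y - i) / rMinusBiased l ξ (y - i)

lemma Backward.ae_hitsAll (h : Backward l ξ) : ∀ᵐ w ∂noiseLaw, HitsAll l ξ w := by
  refine ae_all_iff.2 fun y => ?_
  have h1 := ae_exists_chainFrom_eq (rMinusBiased_pos l ξ) (rPlusBiased_pos l ξ) y (h (y - 1)) y
  simpa only [sub_self, jumpChain_eq_chainFrom] using h1

lemma measurable_rMinusBiased (l : ℝ) (x : ℤ) : Measurable fun ξ => rMinusBiased l ξ x :=
  (measurable_subtype_coe.comp (measurable_fst.comp (measurable_pi_apply x))).mul_const _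

lemma measurable_rPlusBiased (l : ℝ) (x : ℤ) : Measurable fun ξ => rPlusBiased l ξ x :=
  (measurable_subtype_coe.comp (measurable_snd.comp (measurable_pi_apply x))).mul_const _

lemma measurable_totalRate (l : ℝ) (x : ℤ) : Measurable fun ξ => totalRate l ξ x :=
  (measurable_rMinusBiased l x).add (measurable_rPlusBiased l x)

lemma measurable_shift : Measurable shift :=
  measurable_pi_lambda _ fun x => measurable_pi_apply (x + 1)

lemma measurable_jumpChain (l : ℝ) (n : ℕ) :
    Measurable fun q : Env × Noise => jumpChain l q.1 q.2 n := by
  induction n with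
  | zero => exact measurable_const
  | succ n ih =>
    have h2 : Measurable fun q : Env × Noise => ((q.2 n).1 : ℝ) :=
      measurable_subtype_coe.comp (measurable_fst.comp ((measurable_pi_apply n).comp measurable_snd))
    have h3 : Measurable fun q : ℤ × Env => rPlusBiased l q.2 q.1 / totalRate l q.2 q.1 :=
      measurable_from_prod_countable_right fun z =>
        (measurable_rPlusBiased l z).div (measurable_totalRate l z)
    exact Measurable.ite (measurableSet_le h2 (h3.comp (ih.prodMk measurable_fst)))
      ((measurable_from_top (f := fun z : ℤ => z + 1)).comp ih)
      ((measurable_from_top (f := fun z : ℤ => z - 1)).comp ih)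

lemma measurable_jumpTime (l : ℝ) (n : ℕ) :
    Measurable fun q : Env × Noise => jumpTime l q.1 q.2 n := by
  refine Finset.measurable_fun_sum _ fun k _ => ?_
  have h2 : Measurable fun q : Env × Noise => (q.2 k).2 :=
    measurable_snd.comp ((measurable_pi_apply k).comp measurable_snd)
  have h3 : Measurable fun q : ℤ × Env => totalRate l q.2 q.1 :=
    measurable_from_prod_countable_right fun z => measurable_totalRate l z
  exact h2.div (h3.comp ((measurable_jumpChain l k).prodMk measurable_fst))

lemma measurable_ladderStep (l : ℝ) (n : ℕ) :
    Measurable fun q : Env × Noise => ladderStep l q.1 n q.2 := by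
  classical
  have hc : ∀ k, Measurable fun q : Env × Noise => jumpChain l q.1 q.2 k := measurable_jumpChain l
  have heq : (fun q : Env × Noise => ladderStep l q.1 n q.2) =
      fun q : Env × Noise => sInf {k | jumpChain l q.1 q.2 k = n} := by
    ext q
    simp only [ladderStep, hitStep, jumpChain_eq_chainFrom]
  rw [heq]
  set E : Set (Env × Noise) := {q | ∃ k, jumpChain l q.1 q.2 k = n} with hE
  have hEm : MeasurableSet E := by
    rw [hE, Set.ofPred_exists]
    exact MeasurableSet.iUnion fun k => hc k (measurableSet_singleton (n : ℤ))
  refine measurable_to_countable' fun k => ?_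
  have h1 : (fun q : Env × Noise => sInf {k | jumpChain l q.1 q.2 k = n}) ⁻¹' {k} =
      (((fun q : Env × Noise => jumpChain l q.1 q.2 k) ⁻¹' {(n : ℤ)}) ∩
        ⋂ j ∈ Set.Iio k, ((fun q : Env × Noise => jumpChain l q.1 q.2 j) ⁻¹' {(n : ℤ)})ᶜ) ∪
      (Eᶜ ∩ {_q | k = 0}) := by
    ext q
    simp only [Set.mem_preimage, Set.mem_singleton_iff, Set.mem_union, Set.mem_inter_iff,
      Set.mem_iInter, Set.mem_compl_iff, Set.mem_Iio, Set.mem_ofPred_eq, hE]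
    constructor
    · rintro rfl
      by_cases h : ∃ k, jumpChain l q.1 q.2 k = n
      · exact Or.inl ⟨Nat.sInf_mem (s := {k | jumpChain l q.1 q.2 k = n}) h,
          fun j hj => Nat.notMem_of_lt_sInf hj⟩
      · refine Or.inr ⟨h, ?_⟩
        rw [Nat.sInf_eq_zero]
        exact Or.inr (Set.eq_empty_of_forall_notMem fun m hm => h ⟨m, hm⟩)
    · rintro (⟨h1, h2⟩ | ⟨h, rfl⟩)
      · refine le_antisymm (Nat.sInf_le h1) ?_
        by_contra h3
        exact h2 _ (not_le.1 h3)
          (Nat.sInf_mem (s := {k | jumpChain l q.1 q.2 k = n}) ⟨k, h1⟩)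
      · rw [Nat.sInf_eq_zero]
        exact Or.inr (Set.eq_empty_of_forall_notMem fun m hm => h ⟨m, hm⟩)
  rw [h1]
  refine (MeasurableSet.inter (hc k (measurableSet_singleton _)) ?_).union
    (hEm.compl.inter (MeasurableSet.const _))
  exact MeasurableSet.biInter (Set.to_countable _) fun j _ =>
    (hc j (measurableSet_singleton _)).compl

lemma measurable_ladder (l : ℝ) : Measurable (ladder l) :=
  (measurable_shift.comp measurable_fst).prodMk
    (measurable_drop_uncurry.comp ((measurable_ladderStep l 1).prodMk measurable_snd))

lemma measurable_ladderTime (l : ℝ) : Measurable (ladderTime l) := by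
  have h : Measurable fun q : ℕ × (Env × Noise) => jumpTime l q.2.1 q.2.2 q.1 :=
    measurable_from_prod_countable_right fun n => measurable_jumpTime l n
  exact h.comp ((measurable_ladderStep l 1).prodMk measurable_id)

variable {P : Measure Env} [IsProbabilityMeasure P]

/-- The ladder is a skew product over the shift, and for almost every environment its fibre map
preserves the noise law by the strong Markov property. -/
lemma measurePreserving_ladder (hP : MeasurePreserving shift P P)
    (hback : ∀ᵐ ξ ∂P, Backward l ξ) :
    MeasurePreserving (ladder l) (P.prod noiseLaw) (P.prod noiseLaw) := by
  refine hP.skew_product (g := fun ξ w => drop (ladderStep l ξ 1 w) w)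
    (measurable_snd.comp (measurable_ladder l)) ?_
  filter_upwards [hback] with ξ hξ
  refine map_drop_hitStep ?_
  filter_upwards [hξ.ae_hitsAll] with w hw using hw.chainFrom 1

/-- The sections of an invariant set are trivial events of constant probability along the orbit
of the environment. -/
lemma Backward.measure_section (h : Backward l ξ) {A : Set (Env × Noise)} (hA : MeasurableSet A)
    (hinv : ladder l ⁻¹' A = A) {n : ℕ} {B : Set Noise} (hB : MeasurableSet[past n] B) :
    noiseLaw (B ∩ Prod.mk ξ ⁻¹' A) = noiseLaw B * noiseLaw (Prod.mk (shift^[n] ξ) ⁻¹' A) := by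
  have hall := h.ae_hitsAll
  have hit : ∀ᵐ w ∂noiseLaw, ∃ k, chainFrom (rMinusBiased l ξ) (rPlusBiased l ξ) 0 w k = n := by
    filter_upwards [hall] with w hw using hw.chainFrom n
  rw [← measure_inter_drop_hitStep hit (fun w k hk => ?_) hB (measurable_prodMk_left hA)]
  · refine measure_congr ?_
    filter_upwards [hall] with w hw
    refine propext (and_congr_right fun _ => ?_)
    change (ξ, w) ∈ A ↔ (shift^[n] ξ, drop (ladderStep l ξ n w) w) ∈ A
    rw [← ladder_iterate hw n]
    have : (ladder l)^[n] ⁻¹' A = A := by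
      clear hB hit
      induction n with
      | zero => rfl
      | succ n ih => rw [Function.iterate_succ', Set.preimage_comp, hinv, ih]
    exact (Set.ext_iff.1 this (ξ, w)).symm
  -- Reaching `n` takes at least `n` steps, so an event of the first `n` coordinates is decided by
  -- the first visit.
  · have := chainFrom_le (a := rMinusBiased l ξ) (b := rPlusBiased l ξ) 0 w k
    omega

/-- Kolmogorov's argument: the section is independent of the first `n` coordinates for every `n`,
hence of the whole noise, hence of itself. -/
lemma Backward.measure_section_zero_or_one (h : Backward l ξ) {A : Set (Env × Noise)}
    (hA : MeasurableSet A) (hinv : ladder l ⁻¹' A = A) :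
    noiseLaw (Prod.mk ξ ⁻¹' A) = 0 ∨ noiseLaw (Prod.mk ξ ⁻¹' A) = 1 := by
  set S : Set Noise := Prod.mk ξ ⁻¹' A with hS
  have hSm : MeasurableSet S := measurable_prodMk_left hA
  have hgen : MeasurableSpace.generateFrom {S} ≤ (inferInstance : MeasurableSpace Noise) :=
    MeasurableSpace.generateFrom_le (by rintro _ rfl; exact hSm)
  have hind : ∀ n, Indep (past n) (MeasurableSpace.generateFrom {S}) noiseLaw := by
    intro n
    refine IndepSets.indep (past_le n) hgen (@MeasurableSpace.isPiSystem_measurableSet _ (past n))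
      (IsPiSystem.singleton S) (@MeasurableSpace.generateFrom_measurableSet _ (past n)).symm rfl ?_
    rw [IndepSets_iff]
    rintro B _ hB rfl
    have h1 := h.measure_section hA hinv (n := n) (B := Set.univ) MeasurableSet.univ
    rw [Set.univ_inter, measure_univ, one_mul] at h1
    rw [h.measure_section hA hinv hB, ← h1]
  have hfull := indep_iSup_of_directed_le hind past_le hgen past_mono.directed_le
  rw [iSup_past] at hfull
  have h2 := (Indep_iff _ _ _).1 hfull S S hSm (MeasurableSpace.measurableSet_generateFrom rfl)
  rw [Set.inter_self] at h2
  by_cases h0 : noiseLaw S = 0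
  · exact Or.inl h0
  · right
    have := (ENNReal.mul_eq_left h0 (by simp)).1 h2.symm
    exact this

/-- The sections of an invariant set have probability `0` or `1`, and this probability is invariant
under the shift; ergodicity of the environment makes it almost surely constant. -/
theorem ergodic_ladder (hP : Ergodic shift P) (hback : ∀ᵐ ξ ∂P, Backward l ξ) :
    Ergodic (ladder l) (P.prod noiseLaw) := by
  refine ⟨measurePreserving_ladder hP.toMeasurePreserving hback, ⟨fun A hA hinv => ?_⟩⟩
  set g : Env → ENNReal := fun ξ => noiseLaw (Prod.mk ξ ⁻¹' A) with hg
  have hgm : Measurable g := measurable_measure_prodMk_left hA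
  have hgshift : ∀ᵐ ξ ∂P, g (shift ξ) = g ξ := by
    filter_upwards [hback] with ξ hξ
    have h1 := hξ.measure_section hA hinv (n := 1) (B := Set.univ) MeasurableSet.univ
    rw [Set.univ_inter, measure_univ, one_mul] at h1
    exact h1.symm
  have hg01 : ∀ᵐ ξ ∂P, g ξ = 0 ∨ g ξ = 1 := by
    filter_upwards [hback] with ξ hξ using hξ.measure_section_zero_or_one hA hinv
  have hset : MeasurableSet (g ⁻¹' {1}) := hgm (measurableSet_singleton 1)
  have hsinv : shift ⁻¹' (g ⁻¹' {1}) =ᵐ[P] g ⁻¹' {1} := by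
    filter_upwards [hgshift] with ξ hξ
    refine propext ?_
    change g (shift ξ) = 1 ↔ g ξ = 1
    rw [hξ]
  rw [Filter.eventuallyConst_set']
  rcases hP.quasiErgodic.ae_mem_or_ae_notMem₀ hset.nullMeasurableSet hsinv with h | h
  · right
    have : (P.prod noiseLaw) Aᶜ = 0 := by
      rw [Measure.measure_prod_null hA.compl]
      filter_upwards [h] with ξ hξ
      have h1 : g ξ = 1 := hξ
      have h2 : Prod.mk ξ ⁻¹' Aᶜ = (Prod.mk ξ ⁻¹' A)ᶜ := rfl
      rw [h2, prob_compl_eq_one_sub (measurable_prodMk_left hA), show noiseLaw _ = 1 from h1]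
      simp
    exact eventuallyEq_univ.2 this
  · left
    have : (P.prod noiseLaw) A = 0 := by
      rw [Measure.measure_prod_null hA]
      filter_upwards [h, hg01] with ξ hξ h01
      exact h01.resolve_right hξ
    exact ae_eq_empty.2 this

end Ladder

end RWRE

namespace RWRE

/-! ### The annealed mean crossing time. -/

section MeanCrossing

variable {l : ℝ} {ξ : Env}

/-- The mean of the crossing series at the origin. -/
noncomputable def meanCrossing (P : Measure Env) (l : ℝ) : ENNReal :=
  ∫⁻ ξ, crossingSeries (rMinusBiased l ξ) (rPlusBiased l ξ) 0 ∂P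

lemma Backward.lintegral_hittingTime_eq (h : Backward l ξ) :
    ∫⁻ w, hittingTime (rMinusBiased l ξ) (rPlusBiased l ξ) 0 1 w ∂noiseLaw =
      crossingSeries (rMinusBiased l ξ) (rPlusBiased l ξ) 0 := by
  have h1 := lintegral_hittingTime_le (rMinusBiased_pos l ξ) (rPlusBiased_pos l ξ) 1
  have h2 := crossingSeries_le (rMinusBiased_pos l ξ) (rPlusBiased_pos l ξ) 1 h
  rw [sub_self] at h1 h2
  exact le_antisymm h1 h2

lemma ladderTime_eq_hittingTime {w : Noise} (h : HitsAll l ξ w) (hw : ∀ n, 0 ≤ (w n).2) :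
    ENNReal.ofReal (ladderTime l (ξ, w)) =
      hittingTime (rMinusBiased l ξ) (rPlusBiased l ξ) 0 1 w := by
  have h1 := h.chainFrom 1
  rw [Nat.cast_one] at h1
  rw [hittingTime, tsum_eq_sum (s := Finset.range (ladderStep l ξ 1 w))]
  · rw [ladderTime, jumpTime, ENNReal.ofReal_sum_of_nonneg fun k _ =>
      div_nonneg (hw k) (totalRate_pos l ξ _).le]
    refine Finset.sum_congr rfl fun k hk => ?_
    rw [Finset.mem_range] at hk
    have hk' : ∀ j ≤ k, chainFrom (rMinusBiased l ξ) (rPlusBiased l ξ) 0 w j ≠ 1 :=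
      fun j hj => chainFrom_ne_of_lt_hitStep (lt_of_le_of_lt hj hk)
    rw [holdingTime, if_pos hk', jumpChain_eq_chainFrom]
    rfl
  · intro k hk
    rw [Finset.mem_range, not_lt] at hk
    rw [holdingTime, if_neg]
    exact fun h' => h' _ hk (chainFrom_hitStep h1)

variable {P : Measure Env}

lemma lintegral_ladderTime (hback : ∀ᵐ ξ ∂P, Backward l ξ) :
    ∫⁻ q, ENNReal.ofReal (ladderTime l q) ∂(P.prod noiseLaw) = meanCrossing P l := by
  rw [lintegral_prod _ (measurable_ladderTime l).ennreal_ofReal.aemeasurable, meanCrossing]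
  refine lintegral_congr_ae ?_
  filter_upwards [hback] with ξ hξ
  rw [← hξ.lintegral_hittingTime_eq]
  refine lintegral_congr_ae ?_
  filter_upwards [hξ.ae_hitsAll, ae_noise_nonneg] with w h1 h2
  exact ladderTime_eq_hittingTime h1 h2

/-- The first term of the series, `1 / r_0^+(l)`, is strictly positive. As a consequence the
reciprocal of the mean is finite. -/
lemma meanCrossing_ne_zero [IsProbabilityMeasure P] : meanCrossing P l ≠ 0 := by
  intro h
  have hm : Measurable fun ξ => ENNReal.ofReal (1 / rPlusBiased l ξ 0) :=
    (measurable_const.div (measurable_rPlusBiased l 0)).ennreal_ofReal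
  have h1 : ∫⁻ ξ, ENNReal.ofReal (1 / rPlusBiased l ξ 0) ∂P = 0 := by
    refine le_antisymm ?_ zero_le
    rw [← h, meanCrossing]
    refine lintegral_mono fun ξ => ?_
    rw [crossingSeries_rec (rMinusBiased_pos l ξ) (rPlusBiased_pos l ξ)]
    exact le_self_add
  rw [lintegral_eq_zero_iff hm] at h1
  obtain ⟨ξ, hξ⟩ := h1.exists
  have := one_div_pos.2 (rPlusBiased_pos l ξ 0)
  simp only [Pi.zero_apply, ENNReal.ofReal_eq_zero] at hξ
  linarith

end MeanCrossing

/-! ### From first-visit times to the running maximum. -/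

section Path

variable {l : ℝ} {ξ : Env} {w : Noise}

/-- The number of jumps up to time `t`. -/
noncomputable def walkIndex (l : ℝ) (ξ : Env) (w : Noise) (t : ℝ) : ℕ :=
  sInf {n : ℕ | t < jumpTime l ξ w (n + 1)}

lemma walk_eq (t : ℝ) : walk l ξ w t = jumpChain l ξ w (walkIndex l ξ w t) := rfl

lemma monotone_jumpTime (hw : ∀ n, 0 ≤ (w n).2) : Monotone (jumpTime l ξ w) := by
  refine monotone_nat_of_le_succ fun n => ?_
  rw [jumpTime, jumpTime, Finset.sum_range_succ]
  have := div_nonneg (hw n) (totalRate_pos l ξ (jumpChain l ξ w n)).le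
  linarith

lemma lt_jumpTime_walkIndex (hU : Tendsto (jumpTime l ξ w) atTop atTop) (t : ℝ) :
    t < jumpTime l ξ w (walkIndex l ξ w t + 1) := by
  have : ∃ n, t < jumpTime l ξ w (n + 1) :=
    ((hU.comp (tendsto_add_atTop_nat 1)).eventually_gt_atTop t).exists
  exact Nat.sInf_mem (s := {n : ℕ | t < jumpTime l ξ w (n + 1)}) this

lemma jumpTime_walkIndex_le {t : ℝ} (ht : 0 ≤ t) : jumpTime l ξ w (walkIndex l ξ w t) ≤ t := by
  rcases hn : walkIndex l ξ w t with _ | n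
  · simpa [jumpTime] using ht
  · have : n < sInf {n : ℕ | t < jumpTime l ξ w (n + 1)} := by
      change n < walkIndex l ξ w t
      omega
    exact not_lt.1 (Nat.notMem_of_lt_sInf this)

lemma monotone_ladderStep (h : HitsAll l ξ w) : Monotone fun n => ladderStep l ξ n w :=
  monotone_nat_of_le_succ fun n => by
    rw [ladderStep_succ h]
    exact Nat.le_add_right _ _

lemma le_ladderStep (h : HitsAll l ξ w) (n : ℕ) : n ≤ ladderStep l ξ n w := by
  have h1 := chainFrom_le (a := rMinusBiased l ξ) (b := rPlusBiased l ξ) 0 w (ladderStep l ξ n w)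
  rw [← jumpChain_eq_chainFrom, jumpChain_ladderStep h] at h1
  omega

/-- The running maximum `m` of the walk bounds the walk, and its speed `v` is determined by the
times at which the walk first visits the sites `n`. -/
lemma exists_running_max (h : HitsAll l ξ w) (hw : ∀ n, 0 ≤ (w n).2) {v : ℝ}
    (hT : Tendsto (fun n => jumpTime l ξ w (ladderStep l ξ n w)) atTop atTop)
    (hv : Tendsto (fun n : ℕ => n / jumpTime l ξ w (ladderStep l ξ n w)) atTop (𝓝 v)) :
    Tendsto (jumpTime l ξ w) atTop atTop ∧ ∃ m : ℝ → ℕ, Tendsto m atTop atTop ∧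
      Tendsto (fun t => (m t : ℝ) / t) atTop (𝓝 v) ∧
      ∀ t, walk l ξ w t ≤ m t ∧ ladderStep l ξ (m t) w ≤ walkIndex l ξ w t := by
  classical
  have hmono := monotone_jumpTime (l := l) (ξ := ξ) hw
  have hU : Tendsto (jumpTime l ξ w) atTop atTop := by
    refine tendsto_atTop_atTop_of_monotone hmono fun b => ?_
    obtain ⟨n, hn⟩ := (hT.eventually_ge_atTop b).exists
    exact ⟨_, hn⟩
  refine ⟨hU, ?_⟩
  set N : ℕ → ℕ := fun n => ladderStep l ξ n w with hN
  set T : ℕ → ℝ := fun n => jumpTime l ξ w (N n) with hTdef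
  have hTmono : Monotone T := hmono.comp (monotone_ladderStep h)
  -- Searching up to the number of jumps suffices, since the first visit of `k` takes at least `k`
  -- jumps.
  set m : ℝ → ℕ := fun t =>
    Nat.findGreatest (fun k => N k ≤ walkIndex l ξ w t) (walkIndex l ξ w t) with hm
  have hm1 : ∀ t, N (m t) ≤ walkIndex l ξ w t := fun t =>
    Nat.findGreatest_spec (P := fun k => N k ≤ walkIndex l ξ w t) (m := 0) (Nat.zero_le _)
      (by simp [hN, ladderStep_zero])
  have hm2 : ∀ t, walkIndex l ξ w t < N (m t + 1) := by
    intro t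
    by_contra hlt
    rw [not_lt] at hlt
    have h1 : m t + 1 ≤ walkIndex l ξ w t := (le_ladderStep h _).trans hlt
    exact Nat.findGreatest_is_greatest (P := fun k => N k ≤ walkIndex l ξ w t)
      (Nat.lt_succ_self (m t)) h1 hlt
  have hTle : ∀ t, 0 ≤ t → T (m t) ≤ t := fun t ht =>
    (hmono (hm1 t)).trans (jumpTime_walkIndex_le ht)
  have hTlt : ∀ t, t < T (m t + 1) := fun t =>
    (lt_jumpTime_walkIndex hU t).trans_le (hmono (hm2 t))
  have hmtop : Tendsto m atTop atTop := by
    rw [tendsto_atTop]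
    intro K
    filter_upwards [eventually_ge_atTop (T K)] with t ht
    by_contra hlt
    have h1 : T (m t + 1) ≤ T K := hTmono (by omega)
    linarith [hTlt t]
  refine ⟨m, hmtop, ?_, fun t => ⟨?_, hm1 t⟩⟩
  -- From `T (m t) ≤ t < T (m t + 1)`, the ratio `m t / t` lies between `m / T (m + 1)` and `m / T
  -- m` at `m = m t`; the index shift is harmless because `T` tends to infinity.
  · have hshift : Tendsto (fun n : ℕ => (n : ℝ) / T (n + 1)) atTop (𝓝 v) := by
      have h1 : Tendsto (fun n : ℕ => ((n + 1 : ℕ) : ℝ) / T (n + 1) - 1 / T (n + 1)) atTop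
          (𝓝 (v - 0)) := by
        refine (hv.comp (tendsto_add_atTop_nat 1)).sub ?_
        simp only [one_div]
        exact (hT.comp (tendsto_add_atTop_nat 1)).inv_tendsto_atTop
      rw [sub_zero] at h1
      refine h1.congr fun n => ?_
      rw [← sub_div]
      push_cast
      ring
    refine tendsto_of_tendsto_of_tendsto_of_le_of_le' (hshift.comp hmtop) (hv.comp hmtop) ?_ ?_
    · filter_upwards [eventually_gt_atTop 0] with t ht
      exact div_le_div_of_nonneg_left (Nat.cast_nonneg _) ht (hTlt t).le
    · filter_upwards [eventually_gt_atTop 0, hmtop.eventually (hT.eventually_gt_atTop 0)]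
        with t ht htm
      exact div_le_div_of_nonneg_left (Nat.cast_nonneg _) htm (hTle t ht.le)
  · have h1 := chainFrom_lt_of_lt_hitStep (Int.natCast_nonneg _) (hm2 t)
    rw [walk_eq, jumpChain_eq_chainFrom]
    push_cast at h1
    omega

end Path

/-! ### Law of large numbers for transient walks. -/

section Velocity

variable {l : ℝ} {P : Measure Env}

lemma ae_hitsAll_prod (hback : ∀ᵐ ξ ∂P, Backward l ξ) :
    ∀ᵐ q ∂(P.prod noiseLaw), HitsAll l q.1 q.2 ∧ ∀ n, 0 ≤ (q.2 n).2 := by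
  have hm : MeasurableSet {q : Env × Noise | HitsAll l q.1 q.2 ∧ ∀ n, 0 ≤ (q.2 n).2} := by
    have h1 : MeasurableSet {q : Env × Noise | HitsAll l q.1 q.2} := by
      simp only [HitsAll, Set.ofPred_forall, Set.ofPred_exists]
      exact MeasurableSet.iInter fun y => MeasurableSet.iUnion fun n =>
        measurable_jumpChain l n (measurableSet_singleton (y : ℤ))
    have h2 : MeasurableSet {q : Env × Noise | ∀ n, 0 ≤ (q.2 n).2} := by
      rw [Set.ofPred_forall]
      exact MeasurableSet.iInter fun n => measurableSet_le measurable_const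
        (measurable_snd.comp ((measurable_pi_apply n).comp measurable_snd))
    exact h1.inter h2
  rw [Measure.ae_prod_iff_ae_ae hm]
  filter_upwards [hback] with ξ hξ
  exact hξ.ae_hitsAll.and ae_noise_nonneg

variable [IsProbabilityMeasure P]

/-- The walk does not explode and its running maximum has speed `1 / meanCrossing P l`. -/
theorem ae_exists_running_max (hP : Ergodic shift P) (hback : ∀ᵐ ξ ∂P, Backward l ξ) :
    ∀ᵐ q ∂(P.prod noiseLaw), Tendsto (jumpTime l q.1 q.2) atTop atTop ∧
      ∃ m : ℝ → ℕ, Tendsto m atTop atTop ∧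
        Tendsto (fun t => (m t : ℝ) / t) atTop (𝓝 (meanCrossing P l)⁻¹.toReal) ∧
        ∀ t, walk l q.1 q.2 t ≤ m t ∧ ladderStep l q.1 (m t) q.2 ≤ walkIndex l q.1 q.2 t := by
  have hgood := ae_hitsAll_prod hback
  have hnn : 0 ≤ᵐ[P.prod noiseLaw] ladderTime l := by
    filter_upwards [hgood] with q hq
    change 0 ≤ jumpTime l q.1 q.2 _
    exact Finset.sum_nonneg fun k _ => div_nonneg (hq.2 k) (totalRate_pos l q.1 _).le
  have hB := ae_tendsto_div_birkhoffSum (ergodic_ladder hP hback) (measurable_ladderTime l) hnn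
    (by rw [lintegral_ladderTime hback]; exact meanCrossing_ne_zero)
  rw [lintegral_ladderTime hback] at hB
  filter_upwards [hgood, hB] with q h1 h2
  have h3 : ∀ n, birkhoffSum (ladder l) (ladderTime l) n q =
      jumpTime l q.1 q.2 (ladderStep l q.1 n q.2) := fun n => (jumpTime_ladderStep h1.1 n).symm
  simp only [h3] at h2
  exact exists_running_max h1.1 h1.2 h2.1 h2.2

/-- The forward sums of products of `r^- / r^+` converge. -/
def Forward (l : ℝ) (ξ : Env) : Prop :=
  Summable fun m => ∏ i ∈ Finset.range m, rMinusBiased l ξ i / rPlusBiased l ξ i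

/-- The jump chain never falls below `-K`. -/
def boundedBelow (l : ℝ) (K : ℕ) : Set (Env × Noise) := {q | ∀ j, -(K : ℤ) ≤ jumpChain l q.1 q.2 j}

lemma measurableSet_boundedBelow (K : ℕ) : MeasurableSet (boundedBelow l K) := by
  rw [boundedBelow, Set.ofPred_forall]
  exact MeasurableSet.iInter fun j => measurableSet_le measurable_const (measurable_jumpChain l j)

lemma monotone_boundedBelow : Monotone (boundedBelow l) := fun K K' h q hq j => by
  have := hq j
  have : (K : ℤ) ≤ K' := by exact_mod_cast h
  omega

lemma sub_one_le_jumpChain_succ (ξ : Env) (w : Noise) (n : ℕ) :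
    jumpChain l ξ w n - 1 ≤ jumpChain l ξ w (n + 1) := by
  rw [jumpChain_eq_chainFrom, jumpChain_eq_chainFrom, chainFrom_succ]
  split_ifs <;> linarith

lemma neg_le_jumpChain (ξ : Env) (w : Noise) (n : ℕ) : -(n : ℤ) ≤ jumpChain l ξ w n := by
  induction n with
  | zero => simp [jumpChain]
  | succ n ih =>
    have := sub_one_le_jumpChain_succ (l := l) ξ w n
    push_cast
    omega

lemma mem_boundedBelow_zero {ξ : Env} {w : Noise} (h : ∀ n, jumpChain l ξ w n ≠ -1) :
    (ξ, w) ∈ boundedBelow l 0 := by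
  intro j
  induction j with
  | zero => simp [jumpChain]
  | succ n ih =>
    have h1 := sub_one_le_jumpChain_succ (l := l) ξ w n
    have h2 := h (n + 1)
    dsimp only at ih ⊢
    push_cast at ih ⊢
    omega

/-- Being bounded below is not affected by discarding the finitely many steps before the first visit
of `1`, so the event has probability `0` or `1` by ergodicity. Under `Forward` the walk stays
nonnegative with positive probability, which excludes `0`. -/
lemma ae_exists_mem_boundedBelow (hP : Ergodic shift P) (hback : ∀ᵐ ξ ∂P, Backward l ξ)
    (hfor : ∀ᵐ ξ ∂P, Forward l ξ) : ∀ᵐ q ∂(P.prod noiseLaw), q ∈ ⋃ K, boundedBelow l K := by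
  have hm : MeasurableSet (⋃ K, boundedBelow l K) :=
    MeasurableSet.iUnion measurableSet_boundedBelow
  have hinv : ladder l ⁻¹' (⋃ K, boundedBelow l K) =ᵐ[P.prod noiseLaw] ⋃ K, boundedBelow l K := by
    filter_upwards [ae_hitsAll_prod hback] with q hq
    refine propext ?_
    change ladder l q ∈ (⋃ K, boundedBelow l K) ↔ q ∈ ⋃ K, boundedBelow l K
    simp only [Set.mem_iUnion]
    have h1 : ∀ k, jumpChain l q.1 q.2 (ladderStep l q.1 1 q.2 + k) =
        1 + jumpChain l (ladder l q).1 (ladder l q).2 k := fun k => by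
      simpa using jumpChain_add_ladderStep hq.1 1 k
    constructor
    · rintro ⟨K, hK⟩
      refine ⟨K + ladderStep l q.1 1 q.2, fun j => ?_⟩
      rcases lt_or_ge j (ladderStep l q.1 1 q.2) with hj | hj
      · have := neg_le_jumpChain (l := l) q.1 q.2 j
        push_cast
        omega
      · obtain ⟨k, rfl⟩ := Nat.exists_eq_add_of_le hj
        have := hK k
        rw [h1]
        push_cast
        omega
    · rintro ⟨K, hK⟩
      refine ⟨K + 1, fun j => ?_⟩
      have := hK (ladderStep l q.1 1 q.2 + j)
      rw [h1] at this
      push_cast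
      omega
  rcases (ergodic_ladder hP hback).quasiErgodic.ae_mem_or_ae_notMem₀ hm.nullMeasurableSet hinv
    with h | h
  · exact h
  · exfalso
    obtain ⟨ξ, h1, h2⟩ := ((Measure.ae_ae_of_ae_prod h).and hfor).exists
    have h3 := measure_exists_chainFrom_eq_neg_one_lt (rMinusBiased_pos l ξ) (rPlusBiased_pos l ξ) h2
    refine h3.ne ((measure_congr (eventuallyEq_univ.2 ?_)).trans measure_univ)
    filter_upwards [h1] with w hw
    by_contra hne
    refine hw (Set.mem_iUnion.2 ⟨0, mem_boundedBelow_zero fun n hn => hne ⟨n, ?_⟩⟩)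
    rw [← jumpChain_eq_chainFrom, hn]

/-- If the indices `i` with `s i = 1` have asymptotic density larger than `1 - ε`, then there is
one of them in `[(1 - ε) n - 1, n)` for large `n`. -/
lemma exists_index_of_density {s : ℕ → ℝ} (hs : ∀ i, s i = 0 ∨ s i = 1) {ε : ℝ} (hε : ε ≤ 1)
    {n : ℕ} (hn : (1 - ε) * n < ∑ i ∈ Finset.range n, s i) :
    ∃ i < n, (1 - ε) * n - 1 ≤ i ∧ s i = 1 := by
  by_contra hcon
  push Not at hcon
  have h0 : 0 ≤ (1 - ε) * n := mul_nonneg (by linarith) (Nat.cast_nonneg n)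
  have h1 : ∑ i ∈ Finset.range n, s i ≤ ∑ i ∈ Finset.range ⌈(1 - ε) * n - 1⌉₊, (1 : ℝ) := by
    rw [← Finset.sum_filter_add_sum_filter_not (Finset.range n)
      (fun i : ℕ => (i : ℝ) < (1 - ε) * n - 1)]
    have h2 : ∑ i ∈ (Finset.range n).filter (fun i : ℕ => ¬ (i : ℝ) < (1 - ε) * n - 1), s i = 0 := by
      refine Finset.sum_eq_zero fun i hi => ?_
      rw [Finset.mem_filter, Finset.mem_range] at hi
      exact (hs i).resolve_right (hcon i hi.1 (not_lt.1 hi.2))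
    rw [h2, add_zero]
    refine (Finset.sum_le_sum fun i _ => ?_ : _ ≤ ∑ i ∈ (Finset.range n).filter
      (fun i : ℕ => (i : ℝ) < (1 - ε) * n - 1), (1 : ℝ)).trans ?_
    · rcases hs i with h | h <;> rw [h]
      exact zero_le_one
    · refine Finset.sum_le_sum_of_subset_of_nonneg (fun i hi => ?_) fun _ _ _ => zero_le_one
      rw [Finset.mem_filter] at hi
      exact Finset.mem_range.2 (Nat.lt_ceil.2 hi.2)
  rw [Finset.sum_const, Finset.card_range, nsmul_eq_mul, mul_one] at h1
  rcases le_or_gt 0 ((1 - ε) * n - 1) with h | h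
  · have := Nat.ceil_lt_add_one h
    linarith
  · rw [Nat.ceil_eq_zero.2 h.le] at h1
    push_cast at h1
    linarith

/-- After its first visit of `n`, a transient walk stays above `(1 - ε) n - K`. -/
lemma ae_eventually_le_jumpChain (hP : Ergodic shift P) (hback : ∀ᵐ ξ ∂P, Backward l ξ)
    (hfor : ∀ᵐ ξ ∂P, Forward l ξ) {ε : ℝ} (hε0 : 0 < ε) (hε1 : ε ≤ 1) :
    ∃ K : ℝ, ∀ᵐ q ∂(P.prod noiseLaw), ∀ᶠ n : ℕ in atTop, ∀ j, ladderStep l q.1 n q.2 ≤ j →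
      (1 - ε) * n - K ≤ jumpChain l q.1 q.2 j := by
  have hlim : Tendsto (fun K => (P.prod noiseLaw).real (boundedBelow l K)) atTop (𝓝 1) := by
    have h1 := tendsto_measure_iUnion_atTop (μ := P.prod noiseLaw)
      (monotone_boundedBelow (l := l))
    have h2 : (P.prod noiseLaw) (⋃ K, boundedBelow l K) = 1 :=
      (measure_congr (eventuallyEq_univ.2 (ae_exists_mem_boundedBelow hP hback hfor))).trans
        measure_univ
    rw [h2] at h1
    exact (ENNReal.tendsto_toReal ENNReal.one_ne_top).comp h1
  -- With this `K`, Birkhoff gives density above `1 - ε` to the levels `i` after whose first visit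
  -- the walk stays above `i - K`. One such level lies just below `n`, and the bound persists after
  -- the first visit of `n`.
  obtain ⟨K, hK⟩ := (hlim.eventually_const_lt (show 1 - ε < 1 by linarith)).exists
  -- The extra `1` absorbs the rounding in `exists_index_of_density`.
  refine ⟨K + 1, ?_⟩
  have hGm := measurableSet_boundedBelow (l := l) K
  have hB := ae_tendsto_birkhoffSum_div (ergodic_ladder hP hback)
    (f := (boundedBelow l K).indicator 1) (measurable_one.indicator hGm)
    ((integrable_const (1 : ℝ)).indicator hGm)
  rw [integral_indicator_one hGm] at hB
  filter_upwards [hB, ae_hitsAll_prod hback] with q h1 h2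
  filter_upwards [h1.eventually_const_lt hK, eventually_gt_atTop 0] with n hn hn0 j hj
  have hn0' : (0 : ℝ) < n := by exact_mod_cast hn0
  rw [lt_div_iff₀ hn0'] at hn
  obtain ⟨i, hi1, hi2, hi3⟩ := exists_index_of_density
    (s := fun i => (boundedBelow l K).indicator 1 ((ladder l)^[i] q)) (fun i => by
      by_cases h : (ladder l)^[i] q ∈ boundedBelow l K <;> simp [h]) hε1 hn
  have hmem : (ladder l)^[i] q ∈ boundedBelow l K := by
    by_contra h
    simp [h] at hi3
  obtain ⟨k, rfl⟩ := Nat.exists_eq_add_of_le ((monotone_ladderStep h2.1 hi1.le).trans hj)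
  have h3 := jumpChain_add_ladderStep h2.1 i k
  have h4 : -(K : ℤ) ≤ jumpChain l ((ladder l)^[i] (q.1, q.2)).1 ((ladder l)^[i] (q.1, q.2)).2 k :=
    hmem k
  dsimp only
  rw [h3]
  have h5 : -(K : ℝ) ≤ (jumpChain l ((ladder l)^[i] (q.1, q.2)).1
    ((ladder l)^[i] (q.1, q.2)).2 k : ℝ) := by exact_mod_cast h4
  push_cast
  linarith

/-- A walk that is transient to the right has the velocity `1 / meanCrossing P l`. -/
theorem isAsymptoticVelocity_of_forward (hP : Ergodic shift P) (hback : ∀ᵐ ξ ∂P, Backward l ξ)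
    (hfor : ∀ᵐ ξ ∂P, Forward l ξ) : IsAsymptoticVelocity P l (meanCrossing P l)⁻¹.toReal := by
  set v : ℝ := (meanCrossing P l)⁻¹.toReal with hv
  have hv0 : 0 ≤ v := ENNReal.toReal_nonneg
  -- Countably many values `ε = 1 / (k + 1)` keep the exceptional set null.
  have hlow : ∀ᵐ q ∂(P.prod noiseLaw), ∀ k : ℕ, ∃ K : ℝ, ∀ᶠ n : ℕ in atTop, ∀ j,
      ladderStep l q.1 n q.2 ≤ j → (1 - 1 / ((k : ℝ) + 1)) * n - K ≤ jumpChain l q.1 q.2 j := by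
    refine ae_all_iff.2 fun k => ?_
    obtain ⟨K, hK⟩ := ae_eventually_le_jumpChain hP hback hfor (ε := 1 / ((k : ℝ) + 1))
      Nat.one_div_pos_of_nat (by
        rw [div_le_one (by positivity)]
        linarith [(Nat.cast_nonneg k : (0 : ℝ) ≤ k)])
    filter_upwards [hK] with q hq using ⟨K, hq⟩
  refine Measure.ae_ae_of_ae_prod (p := fun q : Env × Noise =>
    Tendsto (jumpTime l q.1 q.2) atTop atTop ∧
      Tendsto (fun t : ℝ => (walk l q.1 q.2 t : ℝ) / t) atTop (𝓝 v)) ?_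
  filter_upwards [ae_exists_running_max hP hback, hlow] with q h1 h2
  obtain ⟨hU, m, hmtop, hmv, hm⟩ := h1
  refine ⟨hU, tendsto_order.2 ⟨fun c hc => ?_, fun c hc => ?_⟩⟩
  · have h3 : Tendsto (fun k : ℕ => (1 - 1 / ((k : ℝ) + 1)) * v) atTop (𝓝 ((1 - 0) * v)) :=
      (tendsto_const_nhds.sub tendsto_one_div_add_atTop_nhds_zero_nat).mul_const v
    rw [sub_zero, one_mul] at h3
    obtain ⟨k, hk⟩ := (h3.eventually_const_lt hc).exists
    obtain ⟨K, hK⟩ := h2 k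
    have h4 : Tendsto (fun t : ℝ => (1 - 1 / ((k : ℝ) + 1)) * (m t / t) - K / t) atTop
        (𝓝 ((1 - 1 / ((k : ℝ) + 1)) * v - 0)) :=
      (hmv.const_mul _).sub (tendsto_const_nhds.div_atTop tendsto_id)
    rw [sub_zero] at h4
    filter_upwards [h4.eventually_const_lt hk, hmtop.eventually hK, eventually_gt_atTop 0]
      with t ht1 ht2 ht3
    refine ht1.trans_le ?_
    have h5 := ht2 _ (hm t).2
    rw [← mul_div_assoc, ← sub_div]
    gcongr
    exact h5
  · filter_upwards [hmv.eventually_lt_const hc, eventually_gt_atTop 0] with t ht1 ht2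
    refine lt_of_le_of_lt ?_ ht1
    gcongr
    exact_mod_cast (hm t).1

end Velocity

end RWRE

namespace RWRE

/-! ### Criteria in terms of `log ρ`, and regularity in the bias. -/

section Averages

variable {l : ℝ} {P : Measure Env}

/-- The spatial shift as a measurable equivalence. -/
def shiftEquiv : Env ≃ᵐ Env where
  toFun := shift
  invFun ξ x := ξ (x - 1)
  left_inv ξ := by ext x <;> simp [shift]
  right_inv ξ := by ext x <;> simp [shift]
  measurable_toFun := measurable_shift
  measurable_invFun := measurable_pi_lambda _ fun x => measurable_pi_apply (x - 1)

lemma shiftEquiv_symm_iterate_apply (n : ℕ) (ξ : Env) (x : ℤ) :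
    (shiftEquiv.symm^[n] ξ) x = ξ (x - n) := by
  induction n generalizing x with
  | zero => simp
  | succ n ih =>
    rw [Function.iterate_succ_apply']
    change (shiftEquiv.symm^[n] ξ) (x - 1) = _
    rw [ih]
    congr 1
    push_cast
    ring

lemma ergodic_shiftEquiv_symm (hP : Ergodic shift P) : Ergodic shiftEquiv.symm P :=
  Ergodic.symm (e := shiftEquiv) hP

lemma rMinus_pos (ξ : Env) (x : ℤ) : 0 < rMinus ξ x := (ξ x).1.2

lemma rPlus_pos (ξ : Env) (x : ℤ) : 0 < rPlus ξ x := (ξ x).2.2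

lemma rho_pos (ξ : Env) (x : ℤ) : 0 < rho ξ x := div_pos (rMinus_pos ξ x) (rPlus_pos ξ x)

lemma measurable_rMinus (x : ℤ) : Measurable fun ξ => rMinus ξ x :=
  measurable_subtype_coe.comp (measurable_fst.comp (measurable_pi_apply x))

lemma measurable_rPlus (x : ℤ) : Measurable fun ξ => rPlus ξ x :=
  measurable_subtype_coe.comp (measurable_snd.comp (measurable_pi_apply x))

lemma measurable_rho (x : ℤ) : Measurable fun ξ => rho ξ x :=
  (measurable_rMinus x).div (measurable_rPlus x)

lemma rho_shift_iterate (n : ℕ) (ξ : Env) (x : ℤ) : rho (shift^[n] ξ) x = rho ξ (x + n) := by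
  simp [rho, rMinus, rPlus, shift_iterate_apply]

lemma rho_shiftEquiv_symm_iterate (n : ℕ) (ξ : Env) (x : ℤ) :
    rho (shiftEquiv.symm^[n] ξ) x = rho ξ (x - n) := by
  simp [rho, rMinus, rPlus, shiftEquiv_symm_iterate_apply]

lemma rPlus_shiftEquiv_symm_iterate (n : ℕ) (ξ : Env) (x : ℤ) :
    rPlus (shiftEquiv.symm^[n] ξ) x = rPlus ξ (x - n) := by
  simp [rPlus, shiftEquiv_symm_iterate_apply]

lemma rMinusBiased_div_rPlusBiased (l : ℝ) (ξ : Env) (x : ℤ) :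
    rMinusBiased l ξ x / rPlusBiased l ξ x = rho ξ x * Real.exp (-(2 * l)) := by
  have h := (rPlus_pos ξ x).ne'
  have h2 : Real.exp (-(2 * l)) = Real.exp (-l) / Real.exp l := by
    rw [← Real.exp_sub]
    congr 1
    ring
  rw [rMinusBiased, rPlusBiased, rho, h2]
  field_simp

lemma exp_log_rho_sub (l : ℝ) (ξ : Env) (x : ℤ) :
    Real.exp (Real.log (rho ξ x) - 2 * l) = rMinusBiased l ξ x / rPlusBiased l ξ x := by
  rw [rMinusBiased_div_rPlusBiased, sub_eq_add_neg, Real.exp_add, Real.exp_log (rho_pos ξ x)]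

lemma exp_sub_log_rho (l : ℝ) (ξ : Env) (x : ℤ) :
    Real.exp (2 * l - Real.log (rho ξ x)) = rPlusBiased l ξ x / rMinusBiased l ξ x := by
  rw [← neg_sub, Real.exp_neg, exp_log_rho_sub, inv_div]

variable [IsProbabilityMeasure P]

lemma ae_forward (hP : Ergodic shift P) (hI : Integrable (fun ξ => Real.log (rho ξ 0)) P)
    (hl : ∫ ξ, Real.log (rho ξ 0) ∂P < 2 * l) : ∀ᵐ ξ ∂P, Forward l ξ := by
  have h := ae_summable_exp_birkhoffSum hP (f := fun ξ => Real.log (rho ξ 0) - 2 * l)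
    ((measurable_rho 0).log.sub_const _) (hI.sub (integrable_const _)) (by
      rw [integral_sub hI (integrable_const _)]
      simpa using hl)
  filter_upwards [h] with ξ hξ
  refine hξ.congr fun n => ?_
  rw [birkhoffSum, Real.exp_sum]
  refine Finset.prod_congr rfl fun i _ => ?_
  rw [rho_shift_iterate, zero_add, exp_log_rho_sub]

/-- Moving the base point by one drops a term and divides the others by the nonzero factor `R y`. -/
lemma summable_backward_sub_one_iff {R : ℤ → ℝ} (hR : ∀ x, R x ≠ 0) (y : ℤ) :
    (Summable fun m => ∏ i ∈ Finset.range m, R (y - 1 - i)) ↔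
      Summable fun m => ∏ i ∈ Finset.range m, R (y - i) := by
  rw [← summable_nat_add_iff 1 (f := fun m => ∏ i ∈ Finset.range m, R (y - i))]
  simp only [Finset.prod_range_succ']
  have h : ∀ i : ℕ, y - ((i + 1 : ℕ) : ℤ) = y - 1 - i := fun i => by push_cast; ring
  simp only [h, Nat.cast_zero, sub_zero]
  rw [summable_mul_right_iff (hR y)]

/-- Read to the left, the products are exponentials of Birkhoff sums of `2l - log ρ_0` under the
inverse shift, whose mean is nonnegative. The critical bias is included, which is essential for the
velocity there. -/
lemma ae_backward (hP : Ergodic shift P) (hI : Integrable (fun ξ => Real.log (rho ξ 0)) P)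
    (hl : ∫ ξ, Real.log (rho ξ 0) ∂P ≤ 2 * l) : ∀ᵐ ξ ∂P, Backward l ξ := by
  have h := ae_not_summable_exp_birkhoffSum (ergodic_shiftEquiv_symm hP)
    (f := fun ξ => 2 * l - Real.log (rho ξ 0))
    (measurable_const.sub (measurable_rho 0).log) ((integrable_const _).sub hI) (by
      rw [integral_sub (integrable_const _) hI]
      simpa using hl)
  filter_upwards [h] with ξ hξ
  set R : ℤ → ℝ := fun x => rPlusBiased l ξ x / rMinusBiased l ξ x with hRdef
  have hR : ∀ x, R x ≠ 0 := fun x => (div_pos (rPlusBiased_pos l ξ x) (rMinusBiased_pos l ξ x)).ne'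
  have h0 : ¬ Summable fun m => ∏ i ∈ Finset.range m, R (0 - i) := by
    intro hs
    refine hξ (hs.congr fun n => ?_)
    rw [birkhoffSum, Real.exp_sum]
    refine Finset.prod_congr rfl fun i _ => ?_
    rw [rho_shiftEquiv_symm_iterate, exp_sub_log_rho]
  intro y
  induction y using Int.induction_on with
  | zero => exact h0
  | succ n ih =>
    intro hs
    refine ih ?_
    have := (summable_backward_sub_one_iff hR ((n : ℤ) + 1)).2 hs
    rwa [add_sub_cancel_right] at this
  | pred n ih =>
    intro hs
    exact ih ((summable_backward_sub_one_iff hR (-(n : ℤ))).1 hs)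

/-- Jensen's inequality for the exponential, in a form that allows an infinite integral. -/
lemma ofReal_exp_integral_le {α : Type*} [MeasurableSpace α] {μ : Measure α}
    [IsProbabilityMeasure μ] {f : α → ℝ} (hfm : Measurable f) (hf : Integrable f μ) :
    ENNReal.ofReal (Real.exp (∫ x, f x ∂μ)) ≤ ∫⁻ x, ENNReal.ofReal (Real.exp (f x)) ∂μ := by
  by_cases htop : ∫⁻ x, ENNReal.ofReal (Real.exp (f x)) ∂μ = ⊤
  · rw [htop]
    exact le_top
  have hnn : 0 ≤ᵐ[μ] fun x => Real.exp (f x) := Eventually.of_forall fun x => (Real.exp_pos _).le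
  have hI : Integrable (fun x => Real.exp (f x)) μ := by
    rw [← lintegral_ofReal_ne_top_iff_integrable hfm.exp.aestronglyMeasurable hnn]
    exact htop
  rw [← ofReal_integral_eq_lintegral_ofReal hI hnn]
  refine ENNReal.ofReal_le_ofReal ?_
  exact convexOn_exp.map_integral_le Real.continuous_exp.continuousOn isClosed_univ
    (Eventually.of_forall fun _ => Set.mem_univ _) hf hI

/-- The coefficients of `meanCrossing P l` as a power series in `exp (-l)`. -/
noncomputable def crossingCoeff (P : Measure Env) (k : ℕ) : ENNReal :=
  ∫⁻ ξ, ENNReal.ofReal (1 / rPlus ξ (-k) * ∏ j ∈ Finset.range k, rho ξ (-j)) ∂P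

omit [IsProbabilityMeasure P] in
lemma meanCrossing_eq_tsum (P : Measure Env) (l : ℝ) : meanCrossing P l =
    ∑' k : ℕ, ENNReal.ofReal (Real.exp (-((2 * k + 1) * l))) * crossingCoeff P k := by
  have hm : ∀ k : ℕ, Measurable fun ξ =>
      ENNReal.ofReal (1 / rPlus ξ (-k) * ∏ j ∈ Finset.range k, rho ξ (-j)) := fun k =>
    ((measurable_const.div (measurable_rPlus _)).mul
      (Finset.measurable_fun_prod _ fun j _ => measurable_rho _)).ennreal_ofReal
  have hterm : ∀ (ξ : Env) (k : ℕ),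
      ENNReal.ofReal (1 / rPlusBiased l ξ (0 - k) *
        ∏ j ∈ Finset.range k, rMinusBiased l ξ (0 - j) / rPlusBiased l ξ (0 - j)) =
      ENNReal.ofReal (Real.exp (-((2 * k + 1) * l))) *
        ENNReal.ofReal (1 / rPlus ξ (-k) * ∏ j ∈ Finset.range k, rho ξ (-j)) := by
    intro ξ k
    rw [← ENNReal.ofReal_mul (Real.exp_pos _).le]
    congr 1
    simp only [rMinusBiased_div_rPlusBiased, zero_sub]
    rw [Finset.prod_mul_distrib, Finset.prod_const, Finset.card_range, ← Real.exp_nat_mul,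
      rPlusBiased]
    have h1 : Real.exp (-((2 * k + 1) * l)) = Real.exp (k * -(2 * l)) / Real.exp l := by
      rw [← Real.exp_sub]
      congr 1
      ring
    have h2 := (rPlus_pos ξ (-k)).ne'
    rw [h1]
    field_simp
  rw [meanCrossing]
  simp only [crossingSeries, hterm]
  rw [lintegral_tsum fun k => ((hm k).const_mul _).aemeasurable]
  exact tsum_congr fun k => lintegral_const_mul _ (hm k)

/-- Jensen's inequality applied to the logarithm of the integrand, whose mean is computed by
stationarity. -/
lemma le_crossingCoeff (hP : Ergodic shift P) (hI : Integrable (fun ξ => Real.log (rho ξ 0)) P)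
    (hI' : Integrable (fun ξ => Real.log (rPlus ξ 0)) P) (k : ℕ) :
    ENNReal.ofReal (Real.exp (- ∫ ξ, Real.log (rPlus ξ 0) ∂P +
      k * ∫ ξ, Real.log (rho ξ 0) ∂P)) ≤ crossingCoeff P k := by
  have hmp : ∀ n : ℕ, MeasurePreserving shiftEquiv.symm^[n] P P := fun n =>
    (ergodic_shiftEquiv_symm hP).toMeasurePreserving.iterate n
  have hcomp : ∀ (n : ℕ) {f : Env → ℝ}, Measurable f → Integrable f P →
      Integrable (fun ξ => f (shiftEquiv.symm^[n] ξ)) P ∧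
        ∫ ξ, f (shiftEquiv.symm^[n] ξ) ∂P = ∫ ξ, f ξ ∂P := by
    intro n f hfm hf
    refine ⟨(hmp n).integrable_comp_of_integrable hf, ?_⟩
    conv_rhs => rw [← (hmp n).map_eq]
    rw [integral_map (hmp n).measurable.aemeasurable hfm.aestronglyMeasurable]
  have hrho : ∀ j : ℕ, Integrable (fun ξ => Real.log (rho ξ (-j))) P ∧
      ∫ ξ, Real.log (rho ξ (-j)) ∂P = ∫ ξ, Real.log (rho ξ 0) ∂P := fun j => by
    simpa only [rho_shiftEquiv_symm_iterate, zero_sub] using hcomp j (measurable_rho 0).log hI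
  have hplus : Integrable (fun ξ => Real.log (rPlus ξ (-k))) P ∧
      ∫ ξ, Real.log (rPlus ξ (-k)) ∂P = ∫ ξ, Real.log (rPlus ξ 0) ∂P := by
    simpa only [rPlus_shiftEquiv_symm_iterate, zero_sub] using hcomp k (measurable_rPlus 0).log hI'
  set φ : Env → ℝ := fun ξ => - Real.log (rPlus ξ (-k)) +
    ∑ j ∈ Finset.range k, Real.log (rho ξ (-j)) with hφ
  have hsumI : Integrable (fun ξ => ∑ j ∈ Finset.range k, Real.log (rho ξ (-j))) P :=
    integrable_finsetSum _ fun j _ => (hrho j).1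
  have hφI : Integrable φ P := hplus.1.neg.add hsumI
  have hφm : Measurable φ := (measurable_rPlus _).log.neg.add
    (Finset.measurable_fun_sum _ fun j _ => (measurable_rho _).log)
  have hint : ∫ ξ, φ ξ ∂P =
      - ∫ ξ, Real.log (rPlus ξ 0) ∂P + k * ∫ ξ, Real.log (rho ξ 0) ∂P := by
    simp only [hφ]
    have hneg : Integrable (fun ξ => - Real.log (rPlus ξ (-k))) P := hplus.1.neg
    rw [integral_add hneg hsumI, integral_neg, hplus.2,
      integral_finsetSum _ fun j _ => (hrho j).1]
    simp only [(hrho _).2]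
    simp
  rw [← hint]
  refine (ofReal_exp_integral_le hφm hφI).trans_eq ?_
  rw [crossingCoeff]
  refine lintegral_congr fun ξ => ?_
  congr 1
  simp only [hφ]
  rw [Real.exp_add, Real.exp_neg, Real.exp_log (rPlus_pos _ _), Real.exp_sum, one_div]
  congr 1
  exact Finset.prod_congr rfl fun j _ => Real.exp_log (rho_pos _ _)

/-- The mean crossing time is infinite unless the walk has a drift to the right. -/
theorem meanCrossing_eq_top (hP : Ergodic shift P)
    (hI : Integrable (fun ξ => Real.log (rho ξ 0)) P)
    (hI' : Integrable (fun ξ => Real.log (rPlus ξ 0)) P)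
    (hl : 2 * l ≤ ∫ ξ, Real.log (rho ξ 0) ∂P) : meanCrossing P l = ⊤ := by
  set m := ∫ ξ, Real.log (rPlus ξ 0) ∂P with hm
  rw [meanCrossing_eq_tsum, ← top_le_iff]
  have h1 : ∑' _ : ℕ, ENNReal.ofReal (Real.exp (-m - l)) = ⊤ :=
    ENNReal.tsum_const_eq_top_of_ne_zero (by simp [Real.exp_pos])
  rw [← h1]
  refine ENNReal.tsum_le_tsum fun k => ?_
  refine le_trans ?_ (mul_le_mul_right (le_crossingCoeff hP hI hI' k) _)
  rw [← ENNReal.ofReal_mul (Real.exp_pos _).le, ← Real.exp_add]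
  -- The exponent is `-m - l + k (E[log ρ_0] - 2l)`, so every term of the series is at least the
  -- same positive constant.
  refine ENNReal.ofReal_le_ofReal (Real.exp_le_exp.2 ?_)
  have hk : (0 : ℝ) ≤ k := Nat.cast_nonneg k
  nlinarith

omit [IsProbabilityMeasure P] in
-- Lower semicontinuity: a finite partial sum exceeding `M` at `l` still does so nearby, and it
-- bounds the series from below.
lemma continuousAt_meanCrossing_of_eq_top (h : meanCrossing P l = ⊤) :
    ContinuousAt (meanCrossing P) l := by
  rw [ContinuousAt, h, ENNReal.tendsto_nhds_top_iff_nnreal]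
  intro M
  have h1 := ENNReal.summable (f := fun k : ℕ =>
    ENNReal.ofReal (Real.exp (-((2 * k + 1) * l))) * crossingCoeff P k) |>.hasSum.tendsto_sum_nat
  rw [← meanCrossing_eq_tsum, h] at h1
  obtain ⟨n, hn⟩ := (h1.eventually_const_lt (ENNReal.coe_lt_top (r := M))).exists
  have h2 : Tendsto (fun l' => ∑ k ∈ Finset.range n,
      ENNReal.ofReal (Real.exp (-((2 * k + 1) * l'))) * crossingCoeff P k) (𝓝 l)
      (𝓝 (∑ k ∈ Finset.range n,
        ENNReal.ofReal (Real.exp (-((2 * k + 1) * l))) * crossingCoeff P k)) := by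
    refine tendsto_finsetSum _ fun k _ => ENNReal.Tendsto.mul_const ?_ (Or.inl ?_)
    · refine ENNReal.tendsto_ofReal (Continuous.tendsto ?_ l)
      fun_prop
    · simp [Real.exp_pos]
  filter_upwards [h2.eventually_const_lt hn] with l' hl'
  refine hl'.trans_le ?_
  rw [meanCrossing_eq_tsum]
  exact ENNReal.sum_le_tsum _

omit [IsProbabilityMeasure P] in
-- Each term decreases in the bias, so the finite series at `l₀` dominates uniformly to the right of
-- `l₀`. Finiteness at `l` alone would leave the left side uncontrolled.
lemma continuousAt_meanCrossing_of_lt {l₀ : ℝ} (hl : l₀ < l) (h : meanCrossing P l₀ ≠ ⊤) :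
    ContinuousAt (meanCrossing P) l := by
  have hterm : ∀ k : ℕ,
      ENNReal.ofReal (Real.exp (-((2 * k + 1) * l₀))) * crossingCoeff P k ≠ ⊤ := fun k =>
    ne_top_of_le_ne_top h (by rw [meanCrossing_eq_tsum]; exact ENNReal.le_tsum k)
  have hC : ∀ k, crossingCoeff P k ≠ ⊤ := by
    intro k hk
    refine hterm k ?_
    rw [hk, ENNReal.mul_top]
    simp [Real.exp_pos]
  set f : ℕ → ℝ → ℝ := fun k x => Real.exp (-((2 * k + 1) * x)) * (crossingCoeff P k).toReal
  have hf : ∀ (k : ℕ) (x : ℝ), ENNReal.ofReal (Real.exp (-((2 * k + 1) * x))) * crossingCoeff P k =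
      ENNReal.ofReal (f k x) := fun k x => by
    simp only [f]
    rw [ENNReal.ofReal_mul (Real.exp_pos _).le, ENNReal.ofReal_toReal (hC k)]
  have hf0 : ∀ k x, 0 ≤ f k x := fun k x => mul_nonneg (Real.exp_pos _).le ENNReal.toReal_nonneg
  have hmono : ∀ k x, l₀ ≤ x → f k x ≤ f k l₀ := fun k x hx => by
    simp only [f]
    gcongr
  have hsum : Summable fun k => f k l₀ := by
    have h1 : ∑' k, ENNReal.ofReal (f k l₀) ≠ ⊤ := by
      simpa only [← hf, ← meanCrossing_eq_tsum] using h
    have := ENNReal.summable_toReal h1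
    simpa only [ENNReal.toReal_ofReal (hf0 _ _)] using this
  have hcont : ContinuousOn (fun x => ∑' k, f k x) (Set.Ici l₀) := by
    refine continuousOn_tsum (u := fun k => f k l₀) (fun k => ?_) hsum fun k x hx => ?_
    · exact Continuous.continuousOn (by fun_prop)
    · rw [Real.norm_eq_abs, abs_of_nonneg (hf0 k x)]
      exact hmono k x hx
  have hat : ContinuousAt (fun x => ENNReal.ofReal (∑' k, f k x)) l :=
    ENNReal.continuous_ofReal.continuousAt.comp (hcont.continuousAt (Ici_mem_nhds hl))
  refine hat.congr ?_
  filter_upwards [Ici_mem_nhds hl] with x hx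
  rw [meanCrossing_eq_tsum]
  simp only [hf]
  exact ENNReal.ofReal_tsum_of_nonneg (fun k => hf0 k x)
    (Summable.of_nonneg_of_le (fun k => hf0 k x) (fun k => hmono k x hx) hsum)

lemma continuousAt_toReal_inv_meanCrossing (h : ContinuousAt (meanCrossing P) l) :
    ContinuousAt (fun x => (meanCrossing P x)⁻¹.toReal) l :=
  (ENNReal.tendsto_toReal (ENNReal.inv_ne_top.2 meanCrossing_ne_zero)).comp
    (((continuous_inv (G := ENNReal)).tendsto _).comp h)

end Averages

/-! ### Left-right symmetry. -/

section Reflection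

/-- The environment reflected at the origin. -/
def reflect : Env ≃ᵐ Env where
  toFun ξ x := ((ξ (-x)).2, (ξ (-x)).1)
  invFun ξ x := ((ξ (-x)).2, (ξ (-x)).1)
  left_inv ξ := by ext x <;> simp
  right_inv ξ := by ext x <;> simp
  measurable_toFun := measurable_pi_lambda _ fun x =>
    (measurable_snd.comp (measurable_pi_apply (-x))).prodMk
      (measurable_fst.comp (measurable_pi_apply (-x)))
  measurable_invFun := measurable_pi_lambda _ fun x =>
    (measurable_snd.comp (measurable_pi_apply (-x))).prodMk
      (measurable_fst.comp (measurable_pi_apply (-x)))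

/-- The noise in which every uniform variable `γ` is replaced by `1 - γ`. -/
def flip (w : Noise) : Noise := fun n => (unitInterval.symm (w n).1, (w n).2)

variable {l : ℝ} {ξ : Env} {w : Noise}

lemma measurePreserving_flip : MeasurePreserving flip noiseLaw noiseLaw := by
  have h1 : MeasurePreserving (Prod.map unitInterval.symm id) stepLaw stepLaw :=
    unitInterval.measurePreserving_symm.prod (MeasurePreserving.id (expMeasure 1))
  refine ⟨measurable_pi_lambda _ fun n => h1.measurable.comp (measurable_pi_apply n), ?_⟩
  have h2 := Measure.infinitePi_map_pi (μ := fun _ : ℕ => stepLaw)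
    (f := fun _ : ℕ => Prod.map unitInterval.symm id) fun _ => h1.measurable
  simp only [h1.map_eq] at h2
  exact h2

lemma rMinus_reflect (ξ : Env) (x : ℤ) : rMinus (reflect ξ) x = rPlus ξ (-x) := rfl

lemma rPlus_reflect (ξ : Env) (x : ℤ) : rPlus (reflect ξ) x = rMinus ξ (-x) := rfl

lemma rho_reflect (ξ : Env) (x : ℤ) : rho (reflect ξ) x = (rho ξ (-x))⁻¹ := by
  rw [rho, rho, rMinus_reflect, rPlus_reflect, inv_div]

lemma rPlusBiased_reflect (l : ℝ) (ξ : Env) (x : ℤ) :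
    rPlusBiased (-l) (reflect ξ) x = rMinusBiased l ξ (-x) := rfl

lemma totalRate_reflect (l : ℝ) (ξ : Env) (x : ℤ) :
    totalRate (-l) (reflect ξ) x = totalRate l ξ (-x) := by
  rw [totalRate, totalRate, rPlusBiased_reflect, add_comm]
  simp [rPlusBiased, rMinusBiased, rMinus_reflect]

/-- The coupling is pathwise: `1 - γ` is at most the reflected probability exactly when `γ` is at
least the original one. Ties would send both chains the wrong way and are excluded by `hw`. -/
lemma jumpChain_reflect
    (hw : ∀ n (x : ℤ), ((w n).1 : ℝ) ≠ rPlusBiased l ξ x / totalRate l ξ x) (n : ℕ) :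
    jumpChain (-l) (reflect ξ) (flip w) n = - jumpChain l ξ w n := by
  induction n with
  | zero => rfl
  | succ n ih =>
    simp only [jumpChain, ih, totalRate_reflect, rPlusBiased_reflect, neg_neg]
    set x := jumpChain l ξ w n
    have h1 : (((flip w) n).1 : ℝ) = 1 - ((w n).1 : ℝ) := rfl
    have h2 : rMinusBiased l ξ x / totalRate l ξ x = 1 - rPlusBiased l ξ x / totalRate l ξ x := by
      have := totalRate_pos l ξ x
      rw [eq_sub_iff_add_eq, ← add_div]
      exact div_self this.ne'
    simp only [h1, h2, sub_le_sub_iff_left]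
    have h3 := hw n x
    by_cases h : ((w n).1 : ℝ) ≤ rPlusBiased l ξ x / totalRate l ξ x
    · rw [if_pos h, if_neg (not_le.2 (lt_of_le_of_ne h h3))]
      ring
    · rw [if_neg h, if_pos (not_le.1 h).le]
      ring

lemma jumpTime_reflect
    (hw : ∀ n (x : ℤ), ((w n).1 : ℝ) ≠ rPlusBiased l ξ x / totalRate l ξ x) (n : ℕ) :
    jumpTime (-l) (reflect ξ) (flip w) n = jumpTime l ξ w n := by
  simp only [jumpTime, jumpChain_reflect hw, totalRate_reflect, neg_neg]
  rfl

lemma walk_reflect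
    (hw : ∀ n (x : ℤ), ((w n).1 : ℝ) ≠ rPlusBiased l ξ x / totalRate l ξ x) (t : ℝ) :
    walk (-l) (reflect ξ) (flip w) t = - walk l ξ w t := by
  simp only [walk, jumpTime_reflect hw, jumpChain_reflect hw]

lemma ae_noise_ne_prob (l : ℝ) (ξ : Env) : ∀ᵐ w ∂noiseLaw,
    ∀ n (x : ℤ), ((w n).1 : ℝ) ≠ rPlusBiased l ξ x / totalRate l ξ x :=
  ae_all_iff.2 fun n => ae_all_iff.2 fun _ => ae_noise_ne _ n

variable {P : Measure Env}

lemma measurePreserving_reflect (P : Measure Env) : MeasurePreserving reflect P (P.map reflect) :=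
  reflect.measurable.measurePreserving P

/-- Reflection conjugates the shift with its inverse. -/
lemma ergodic_map_reflect (hP : Ergodic shift P) : Ergodic shift (P.map reflect) := by
  have h := (measurePreserving_reflect P).ergodic_conjugate_iff.2 (ergodic_shiftEquiv_symm hP)
  convert h using 1
  funext ξ x
  change ξ (x + 1) = ((ξ (-(-x - 1))).1, (ξ (-(-x - 1))).2)
  rw [show -(-x - 1) = x + 1 by ring]

lemma integral_map_reflect : ∫ ξ, Real.log (rho ξ 0) ∂(P.map reflect) =
    - ∫ ξ, Real.log (rho ξ 0) ∂P := by
  rw [integral_map reflect.measurable.aemeasurable (measurable_rho 0).log.aestronglyMeasurable,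
    ← integral_neg]
  simp [rho_reflect]

lemma integrable_map_reflect (hI : Integrable (fun ξ => Real.log (rho ξ 0)) P) :
    Integrable (fun ξ => Real.log (rho ξ 0)) (P.map reflect) := by
  rw [integrable_map_measure (measurable_rho 0).log.aestronglyMeasurable
    reflect.measurable.aemeasurable]
  refine hI.neg.congr (Eventually.of_forall fun ξ => ?_)
  simp [rho_reflect]

lemma integrable_map_reflect_rPlus (hI : Integrable (fun ξ => Real.log (rMinus ξ 0)) P) :
    Integrable (fun ξ => Real.log (rPlus ξ 0)) (P.map reflect) := by
  rw [integrable_map_measure (measurable_rPlus 0).log.aestronglyMeasurable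
    reflect.measurable.aemeasurable]
  exact hI

lemma IsAsymptoticVelocity.of_reflect {v : ℝ} (h : IsAsymptoticVelocity (P.map reflect) (-l) v) :
    IsAsymptoticVelocity P l (-v) := by
  have h1 := (measurePreserving_reflect P).quasiMeasurePreserving.ae h
  filter_upwards [h1] with ξ hξ
  filter_upwards [measurePreserving_flip.quasiMeasurePreserving.ae hξ, ae_noise_ne_prob l ξ]
    with w h2 h3
  refine ⟨h2.1.congr fun n => jumpTime_reflect h3 n, ?_⟩
  refine h2.2.neg.congr fun t => ?_
  rw [walk_reflect h3]
  push_cast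
  ring

variable [IsProbabilityMeasure P]

instance : IsProbabilityMeasure (P.map reflect) :=
  Measure.isProbabilityMeasure_map reflect.measurable.aemeasurable

lemma measurePreserving_reflect_flip : MeasurePreserving (Prod.map reflect flip)
    (P.prod noiseLaw) ((P.map reflect).prod noiseLaw) :=
  (measurePreserving_reflect P).prod measurePreserving_flip

end Reflection

/-! ### Integrability, the critical bias and the velocity formula. -/

section Main

variable {P : Measure Env}

lemma IsAsymptoticVelocity.unique [IsProbabilityMeasure P] {l v v' : ℝ}
    (h : IsAsymptoticVelocity P l v) (h' : IsAsymptoticVelocity P l v') : v = v' := by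
  obtain ⟨ξ, h1, h2⟩ := (h.and h').exists
  obtain ⟨w, h3, h4⟩ := (h1.and h2).exists
  exact tendsto_nhds_unique h3.2 h4.2

lemma IsAsymptoticVelocity.velocity_eq [IsProbabilityMeasure P] {l v : ℝ}
    (h : IsAsymptoticVelocity P l v) : velocity P l = v := by
  have hex : ∃ v, IsAsymptoticVelocity P l v := ⟨v, h⟩
  rw [velocity, dif_pos hex]
  exact hex.choose_spec.unique h

/-- The negative part of `log f` is controlled by `1 / f` through `log u ≤ u - 1` at `u = 1 / f`. -/
lemma integrable_log {f : Env → ℝ} (hm : Measurable f) (hpos : ∀ ξ, 0 < f ξ)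
    (hinv : Integrable (fun ξ => 1 / f ξ) P) (hlog : Integrable (fun ξ => Real.posLog (f ξ)) P) :
    Integrable (fun ξ => Real.log (f ξ)) P := by
  refine (hlog.add hinv).mono' hm.log.aestronglyMeasurable (Eventually.of_forall fun ξ => ?_)
  have h := hpos ξ
  have h1 : Real.log (1 / f ξ) ≤ 1 / f ξ - 1 := Real.log_le_sub_one_of_pos (one_div_pos.2 h)
  rw [one_div, Real.log_inv, ← one_div] at h1
  have h2 : 0 ≤ Real.posLog (f ξ) := Real.posLog_nonneg
  have h3 : Real.log (f ξ) ≤ Real.posLog (f ξ) := le_max_right _ _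
  have h4 := one_div_pos.2 h
  simp only [Pi.add_apply, Real.norm_eq_abs, abs_le]
  constructor <;> linarith

variable [IsProbabilityMeasure P]

/-- At the bias where `log ρ` is centred the walk has velocity zero. -/
lemma isAsymptoticVelocity_critical (hP : Ergodic shift P)
    (hI : Integrable (fun ξ => Real.log (rho ξ 0)) P)
    (hIp : Integrable (fun ξ => Real.log (rPlus ξ 0)) P)
    (hIm : Integrable (fun ξ => Real.log (rMinus ξ 0)) P) {l : ℝ}
    (hl : 2 * l = ∫ ξ, Real.log (rho ξ 0) ∂P) : IsAsymptoticVelocity P l 0 := by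
  have hP' := ergodic_map_reflect hP
  have hI' := integrable_map_reflect hI
  have hl' : 2 * (-l) = ∫ ξ, Real.log (rho ξ 0) ∂(P.map reflect) := by
    rw [integral_map_reflect, ← hl]
    ring
  have h1 := ae_exists_running_max hP (ae_backward hP hI hl.ge)
  -- The running maximum of the reflected walk is transported to the same environment and noise,
  -- where it bounds the original walk from below.
  have h2 := measurePreserving_reflect_flip.quasiMeasurePreserving.ae
    (ae_exists_running_max hP' (ae_backward hP' hI' hl'.ge))
  rw [meanCrossing_eq_top hP hI hIp hl.le] at h1
  rw [meanCrossing_eq_top hP' hI' (integrable_map_reflect_rPlus hIm) hl'.le] at h2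
  filter_upwards [Measure.ae_ae_of_ae_prod h1, Measure.ae_ae_of_ae_prod h2] with ξ h3 h4
  filter_upwards [h3, h4, ae_noise_ne_prob l ξ] with w h5 h6 h7
  obtain ⟨hU, m, -, hm, hle⟩ := h5
  obtain ⟨-, m', -, hm', hle'⟩ := h6
  refine ⟨hU, ?_⟩
  simp only [ENNReal.inv_top, ENNReal.toReal_zero] at hm hm'
  have hm'' := hm'.neg
  rw [neg_zero] at hm''
  refine tendsto_of_tendsto_of_tendsto_of_le_of_le' hm'' hm ?_ ?_
  · filter_upwards [eventually_gt_atTop 0] with t ht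
    have h8 := (hle' t).1
    simp only [Prod.map_fst, Prod.map_snd] at h8
    rw [walk_reflect h7] at h8
    rw [← neg_div]
    gcongr
    have h9 : -(m' t : ℤ) ≤ walk l ξ w t := by omega
    exact_mod_cast h9
  · filter_upwards [eventually_gt_atTop 0] with t ht
    gcongr
    exact_mod_cast (hle t).1

/-- The law of large numbers, with the velocity given by the mean crossing times to the right and
to the left. -/
theorem isAsymptoticVelocity_formula (hP : Ergodic shift P)
    (hI : Integrable (fun ξ => Real.log (rho ξ 0)) P)
    (hIp : Integrable (fun ξ => Real.log (rPlus ξ 0)) P)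
    (hIm : Integrable (fun ξ => Real.log (rMinus ξ 0)) P) (l : ℝ) :
    IsAsymptoticVelocity P l
      ((meanCrossing P l)⁻¹.toReal - (meanCrossing (P.map reflect) (-l))⁻¹.toReal) := by
  have hP' := ergodic_map_reflect hP
  have hI' := integrable_map_reflect hI
  have hIp' := integrable_map_reflect_rPlus hIm
  have hint := integral_map_reflect (P := P)
  -- In each case at least one of the two crossing means is infinite, so its reciprocal drops out of
  -- the formula.
  rcases lt_trichotomy (2 * l) (∫ ξ, Real.log (rho ξ 0) ∂P) with hl | hl | hl
  · have hl' : ∫ ξ, Real.log (rho ξ 0) ∂(P.map reflect) < 2 * (-l) := by linarith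
    rw [meanCrossing_eq_top hP hI hIp hl.le, ENNReal.inv_top, ENNReal.toReal_zero, zero_sub]
    exact (isAsymptoticVelocity_of_forward hP' (ae_backward hP' hI' hl'.le)
      (ae_forward hP' hI' hl')).of_reflect
  · rw [meanCrossing_eq_top hP hI hIp hl.le, meanCrossing_eq_top hP' hI' hIp' (by linarith),
      ENNReal.inv_top, ENNReal.toReal_zero, sub_zero]
    exact isAsymptoticVelocity_critical hP hI hIp hIm hl
  · rw [meanCrossing_eq_top hP' hI' hIp' (by linarith), ENNReal.inv_top, ENNReal.toReal_zero,
      sub_zero]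
    exact isAsymptoticVelocity_of_forward hP (ae_backward hP hI hl.le) (ae_forward hP hI hl)

end Main

end RWRE

theorem proposition4p5 (P : Measure RWRE.Env) [IsProbabilityMeasure P]
    (hErg : Ergodic RWRE.shift P)
    (hInvMinus : Integrable (fun ξ => 1 / RWRE.rMinus ξ 0) P)
    (hInvPlus : Integrable (fun ξ => 1 / RWRE.rPlus ξ 0) P)
    (hLogMinus : Integrable (fun ξ => Real.posLog (RWRE.rMinus ξ 0)) P)
    (hLogPlus : Integrable (fun ξ => Real.posLog (RWRE.rPlus ξ 0)) P) :
    (∀ l : ℝ, RWRE.IsAsymptoticVelocity P l (RWRE.velocity P l)) ∧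
    (RWRE.lambdaMinus P = RWRE.lambdaPlus P →
      Continuous (RWRE.velocity P) ∧
      Integrable (fun ξ => Real.log (RWRE.rho ξ 0)) P ∧
      RWRE.lambdaMinus P = (((1 / 2 : ℝ) * ∫ ξ, Real.log (RWRE.rho ξ 0) ∂P : ℝ) : EReal) ∧
      RWRE.lambdaPlus P = (((1 / 2 : ℝ) * ∫ ξ, Real.log (RWRE.rho ξ 0) ∂P : ℝ) : EReal) ∧
      RWRE.velocity P ((1 / 2 : ℝ) * ∫ ξ, Real.log (RWRE.rho ξ 0) ∂P) = 0) := by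
  have hIm := RWRE.integrable_log (RWRE.measurable_rMinus 0) (fun ξ => RWRE.rMinus_pos ξ 0)
    hInvMinus hLogMinus
  have hIp := RWRE.integrable_log (RWRE.measurable_rPlus 0) (fun ξ => RWRE.rPlus_pos ξ 0)
    hInvPlus hLogPlus
  have hI : Integrable (fun ξ => Real.log (RWRE.rho ξ 0)) P := by
    refine (hIm.sub hIp).congr (Eventually.of_forall fun ξ => ?_)
    exact (Real.log_div (RWRE.rMinus_pos ξ 0).ne' (RWRE.rPlus_pos ξ 0).ne').symm
  have hErg' := RWRE.ergodic_map_reflect hErg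
  have hI' := RWRE.integrable_map_reflect hI
  have hIp' := RWRE.integrable_map_reflect_rPlus hIm
  have hint := RWRE.integral_map_reflect (P := P)
  have hvel := RWRE.isAsymptoticVelocity_formula hErg hI hIp hIm
  have hformula : ∀ l, RWRE.velocity P l = (RWRE.meanCrossing P l)⁻¹.toReal -
      (RWRE.meanCrossing (P.map RWRE.reflect) (-l))⁻¹.toReal := fun l => (hvel l).velocity_eq
  refine ⟨fun l => by rw [(hvel l).velocity_eq]; exact hvel l, fun heq => ?_⟩
  set c : ℝ := (1 / 2 : ℝ) * ∫ ξ, Real.log (RWRE.rho ξ 0) ∂P with hc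
  have htop : ∀ l ≤ c, RWRE.meanCrossing P l = ⊤ := fun l hl =>
    RWRE.meanCrossing_eq_top hErg hI hIp (by linarith)
  have htop' : ∀ l, c ≤ l → RWRE.meanCrossing (P.map RWRE.reflect) (-l) = ⊤ := fun l hl =>
    RWRE.meanCrossing_eq_top hErg' hI' hIp' (by linarith)
  have hfin : ∀ l, 0 < RWRE.velocity P l → RWRE.meanCrossing P l ≠ ⊤ := by
    intro l hl h
    rw [hformula, h, ENNReal.inv_top, ENNReal.toReal_zero, zero_sub] at hl
    linarith [(ENNReal.toReal_nonneg : 0 ≤ (RWRE.meanCrossing (P.map RWRE.reflect) (-l))⁻¹.toReal)]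
  have hfin' : ∀ l, RWRE.velocity P l < 0 → RWRE.meanCrossing (P.map RWRE.reflect) (-l) ≠ ⊤ := by
    intro l hl h
    rw [hformula, h, ENNReal.inv_top, ENNReal.toReal_zero, sub_zero] at hl
    linarith [(ENNReal.toReal_nonneg : 0 ≤ (RWRE.meanCrossing P l)⁻¹.toReal)]
  have hplus : (c : EReal) ≤ RWRE.lambdaPlus P := by
    refine le_sInf ?_
    rintro _ ⟨l, hl, rfl⟩
    rw [EReal.coe_le_coe_iff]
    by_contra h
    exact hfin l hl (htop l (not_le.1 h).le)
  have hminus : RWRE.lambdaMinus P ≤ (c : EReal) := by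
    refine sSup_le ?_
    rintro _ ⟨l, hl, rfl⟩
    rw [EReal.coe_le_coe_iff]
    by_contra h
    exact hfin' l hl (htop' l (not_le.1 h).le)
  -- The bounds `λ_- ≤ c ≤ λ_+` hold in general; the assumed equality closes the gap.
  have hplus_eq : RWRE.lambdaPlus P = c := le_antisymm (heq ▸ hminus) hplus
  have hminus_eq : RWRE.lambdaMinus P = c := heq.trans hplus_eq
  refine ⟨?_, hI, hminus_eq, hplus_eq, ?_⟩
  · have hcont : ∀ l, ContinuousAt (RWRE.meanCrossing P) l := by
      intro l
      rcases le_or_gt l c with h | h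
      · exact RWRE.continuousAt_meanCrossing_of_eq_top (htop l h)
      -- Since `λ_+ = c < l`, some `l₀ < l` has positive velocity, hence a finite crossing mean that
      -- dominates near `l`.
      · have h1 : RWRE.lambdaPlus P < (l : EReal) := by
          rw [hplus_eq]
          exact_mod_cast h
        obtain ⟨_, ⟨l₀, hl₀, rfl⟩, h2⟩ := sInf_lt_iff.1 h1
        exact RWRE.continuousAt_meanCrossing_of_lt (EReal.coe_lt_coe_iff.1 h2) (hfin l₀ hl₀)
    have hcont' : ∀ l, ContinuousAt (RWRE.meanCrossing (P.map RWRE.reflect)) (-l) := by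
      intro l
      rcases le_or_gt c l with h | h
      · exact RWRE.continuousAt_meanCrossing_of_eq_top (htop' l h)
      · have h1 : (l : EReal) < RWRE.lambdaMinus P := by
          rw [hminus_eq]
          exact_mod_cast h
        obtain ⟨_, ⟨l₀, hl₀, rfl⟩, h2⟩ := lt_sSup_iff.1 h1
        exact RWRE.continuousAt_meanCrossing_of_lt (neg_lt_neg (EReal.coe_lt_coe_iff.1 h2))
          (hfin' l₀ hl₀)
    rw [funext hformula, continuous_iff_continuousAt]
    intro l
    refine (RWRE.continuousAt_toReal_inv_meanCrossing (hcont l)).sub ?_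
    exact ContinuousAt.comp (f := fun x : ℝ => -x)
      (RWRE.continuousAt_toReal_inv_meanCrossing (hcont' l)) continuous_neg.continuousAt
  · rw [hformula, htop c le_rfl, htop' c le_rfl]
    simp
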